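/- Let $\mathcal{G}$ be a finite DAG on a vertex set $\bm V$ and let $\mathcal{S}$ be a mixed policy scope: a set of decisions $\bm X(\mathcal{S})\subseteq \bm V$ together with a set of contexts $\bm C_X\subseteq \bm V$ for each decision $X$; for a set $D$ of decisions write $\bm C_D=\bigcup_{X\in D}\bm C_X$. The scoped graph $\mathcal{G}_{\mathcal{S}}$ is obtained from $\mathcal{G}$ by replacing, for each decision $X$, all edges into $X$ by the edges $C\to X$, $C\in \bm C_X$; it is assumed to be acyclic. Let $Y\in \bm V$ be an outcome vertex that is neither a decision nor a context of a decision. For $\bm W\subseteq \bm V$ let $\lceil \bm W\rceil$ be the least set that contains $\bm W$ and contains every decision $X$ with $\bm C_X\subseteq\lceil \bm W\rceil$. "d-connected" means not d-separated, where a path with an endpoint in the conditioning set counts as blocked. Suppose that, for every decision $X\in \bm X(\mathcal{S})$: (A) $X$ is an ancestor of $Y$ in $\mathcal{G}_{\mathcal{S}}$; (B) every $C\in \bm C_X$ is d-connected to $Y$ in $\mathcal{G}_{\mathcal{S}}$ given $\{X\}\cup(\bm C_X\setminus\{C\})$; (C) for every $Z\in \bm C_X$, in the graph obtained from $\mathcal{G}_{\mathcal{S}}$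 by adding a new vertex $\pi_X$ with the single edge $\pi_X\to X$, the vertex $\pi_X$ is d-connected to $Y$ given $\big\lceil (\bm X(\mathcal{S})\cup \bm C_{\bm X(\mathcal{S})\setminus\{Z\}})\setminus\{Z\}\big\rceil$. Then for every decision $X_0\in \bm X(\mathcal{S})$ and every context $Z_0\in \bm C_{X_0}$ there is a structural causal model with finite domains and real-valued $Y$, compatible with $\mathcal{G}$ (the endogenous arguments of each mechanism are the parents in $\mathcal{G}$, and the exogenous arguments of different mechanisms are independent), in which $Z_0$ is material for $X_0$: the maximum of $\mathbb{E}[Y]$ over all policies that choose each decision $X$ at random according to a conditional distribution given $\bm C_X$ is strictly larger than the same maximum when $\bm C_{X_0}$ is replaced by $\bm C_{X_0}\setminus\{Z_0\}$. -/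

import Mathlib

/-! ### Directed graphs and d-separation -/

/-- A directed graph is a DAG if it has no directed cycle. -/
def IsDAG {V : Type*} (G : Digraph V) : Prop :=
  ∀ v, ¬ Relation.TransGen G.Adj v v

/-- `IsAnc G a b`: the vertex `a` is an ancestor of `b`, every vertex being an ancestor of
itself. -/
def IsAnc {V : Type*} (G : Digraph V) (a b : V) : Prop :=
  Relation.ReflTransGen G.Adj a b

/-- A path from `a` to `b`, as the list of its vertices: consecutive vertices are joined by an
edge in either direction, and no vertex is repeated. -/
structure IsPath {V : Type*} (G : Digraph V) (p : List V) (a b : V) : Prop where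
  nodup : p.Nodup
  edges : p.IsChain (fun v w => G.Adj v w ∨ G.Adj w v)
  head : p.head? = some a
  last : p.getLast? = some b

/-- The path `p` from `a` to `b` is d-separated (blocked) by the set `Z`. -/
def PathBlocked {V : Type*} (G : Digraph V) (Z : Set V) (p : List V) (a b : V) : Prop :=
  (∃ u w v, [u, w, v] <:+: p ∧ (G.Adj u w ∧ G.Adj v w) ∧ ∀ d, IsAnc G w d → d ∉ Z) ∨
  (∃ u w v, [u, w, v] <:+: p ∧ (G.Adj w u ∨ G.Adj w v) ∧ w ∈ Z) ∨
  (a ∈ Z ∨ b ∈ Z)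

/-- The set `Z` d-separates `A` from `B`: it d-separates every path from `A` to `B`. -/
def DSeparated {V : Type*} (G : Digraph V) (A B Z : Set V) : Prop :=
  ∀ a ∈ A, ∀ b ∈ B, ∀ p, IsPath G p a b → PathBlocked G Z p a b

/-- `A` and `B` are d-connected given `Z`. -/
def DConnected {V : Type*} (G : Digraph V) (A B Z : Set V) : Prop :=
  ¬ DSeparated G A B Z

/-- The graph obtained from `G` by adding one new vertex (`none`, the policy node `π_X`) whose only
edge is `π_X → X`. -/
def withPolicyNode {V : Type*} (G : Digraph V) (X : V) : Digraph (Option V) where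
  Adj
    | some a, some b => G.Adj a b
    | none, some b => b = X
    | _, none => False

/-! ### Mixed policy scopes -/

/-- A mixed policy scope: a set of decisions and a set of contexts for each decision. The value of
`ctx` at a vertex that is not a decision is never used. -/
structure MixedPolicyScope (V : Type*) where
  decisions : Finset V
  ctx : V → Finset V

namespace MixedPolicyScope

variable {V : Type*}

/-- The scoped graph: all edges into a decision `X` are replaced by the edges `C → X` from the
contexts `C` of `X`. -/
def scopedGraph (S : MixedPolicyScope V) (G : Digraph V) : Digraph V where
  Adj a b := (b ∈ S.decisions ∧ a ∈ S.ctx b) ∨ (b ∉ S.decisions ∧ G.Adj a b)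

/-- The set of all contexts of the decisions in `D`. -/
def ctxOf (S : MixedPolicyScope V) (D : Set V) : Set V :=
  {c | ∃ X ∈ D, c ∈ S.ctx X}

/-- The implied variables `⌈W⌉`: the least set that contains `W` and every decision all of whose
contexts it contains. -/
inductive Implied (S : MixedPolicyScope V) (W : Set V) : V → Prop
  | base {v : V} (h : v ∈ W) : Implied S W v
  | step {X : V} (hX : X ∈ S.decisions) (h : ∀ c ∈ S.ctx X, Implied S W c) : Implied S W X

/-- The implied variables `⌈W⌉`, as a set. -/
def implied (S : MixedPolicyScope V) (W : Set V) : Set V := {v | S.Implied W v}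

open scoped Classical in
/-- The scope in which `Z` is removed from the contexts of `X`. -/
noncomputable def removeContext (S : MixedPolicyScope V) (X Z : V) : MixedPolicyScope V where
  decisions := S.decisions
  ctx := Function.update S.ctx X (S.ctx X \ {Z})

end MixedPolicyScope

/-! ### Structural causal models -/

universe u

/-- A structural causal model with endogenous variables `V`, finite domains, and a real-valued
outcome variable `Y`. -/
structure SCM (V : Type u) (Y : V) where
  /-- The exogenous variables. -/
  U : Type u
  [fintypeU : Fintype U]
  /-- The domains of the exogenous variables. -/
  exoDom : U → Type
  [fintypeExoDom : ∀ i, Fintype (exoDom i)]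
  /-- The joint distribution of the exogenous variables. -/
  prob : (∀ i, exoDom i) → ℝ
  prob_nonneg : ∀ e, 0 ≤ prob e
  prob_sum : haveI := Classical.decEq U; ∑ e, prob e = 1
  /-- The domains of the endogenous variables. -/
  dom : V → Type
  [fintypeDom : ∀ v, Fintype (dom v)]
  [nonemptyDom : ∀ v, Nonempty (dom v)]
  /-- The endogenous variables that are arguments of the mechanism of a variable. -/
  pa : V → Finset V
  not_mem_pa : ∀ v, v ∉ pa v
  /-- The exogenous variables that are arguments of the mechanism of a variable. -/
  exo : V → Finset U
  /-- The mechanisms. -/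
  f : ∀ v, (∀ w : pa v, dom w) → (∀ i : exo v, exoDom i) → dom v
  /-- The domain of `Y` consists of real numbers. -/
  value : dom Y → ℝ
  value_injective : Function.Injective value

attribute [instance] SCM.fintypeU SCM.fintypeExoDom SCM.fintypeDom SCM.nonemptyDom

namespace SCM

variable {V : Type u} [Fintype V] {Y : V}

open scoped Classical in
/-- The probability of an event about the exogenous variables. -/
noncomputable def exoProb (M : SCM V Y) (E : (∀ i, M.exoDom i) → Prop) : ℝ :=
  ∑ e, if E e then M.prob e else 0

open scoped Classical in
/-- The model is compatible with the DAG `G`: the induced graph is `G`, that is, the endogenous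
arguments of each mechanism are the parents in `G`, and there are no bidirected edges, that is, the
families of exogenous arguments of the different mechanisms are independent. -/
def CompatibleWith (M : SCM V Y) (G : Digraph V) : Prop :=
  (∀ v w, w ∈ M.pa v ↔ G.Adj w v) ∧
  ∀ a : (∀ v, ∀ i : M.exo v, M.exoDom i),
    M.exoProb (fun e => ∀ v, ∀ i : M.exo v, e i = a v i) =
      ∏ v, M.exoProb (fun e => ∀ i : M.exo v, e i = a v i)

open scoped Classical in
/-- The interventional distribution: for a full assignment `x`, this is the probability, under the
intervention that fixes every variable in `D` to its value in `x`, that every other variable takes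
its value in `x`. -/
noncomputable def doProb (M : SCM V Y) (D : Finset V) (x : ∀ v, M.dom v) : ℝ :=
  ∑ e : (∀ i, M.exoDom i),
    (∏ v ∈ Finset.univ.filter (fun v => v ∉ D),
      if M.f v (fun w => x w) (fun i => e i) = x v then (1 : ℝ) else 0) * M.prob e

/-- A mixed policy: for each decision a decision rule, which gives for each assignment to the
contexts a probability distribution on the domain of the decision. -/
abbrev Policy (M : SCM V Y) (S : MixedPolicyScope V) : Type u :=
  ∀ X : S.decisions, (∀ c : S.ctx X, M.dom c) → stdSimplex ℝ (M.dom X)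

open scoped Classical in
/-- The expected utility of a policy: the sum of `y * P_x(v) * ∏ π(x | c_x)` over all assignments,
where `P_x` is the distribution under the intervention on all the decisions. -/
noncomputable def expectedUtility (M : SCM V Y) (S : MixedPolicyScope V) (π : M.Policy S) : ℝ :=
  ∑ x : (∀ v, M.dom v), M.value (x Y) * M.doProb S.decisions x *
    ∏ X : S.decisions, (π X (fun c => x c)).1 (x X)

/-- The maximum expected utility over the policies that follow the scope. -/
noncomputable def meu (M : SCM V Y) (S : MixedPolicyScope V) : ℝ :=
  sSup (Set.range (M.expectedUtility S))

/-- The supremum that defines the maximum expected utility is attained. -/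
theorem isGreatest_meu (M : SCM V Y) (S : MixedPolicyScope V) :
    IsGreatest (Set.range (M.expectedUtility S)) (M.meu S) := by
  classical
  have hc : Continuous (M.expectedUtility S) := by
    unfold expectedUtility
    refine continuous_finsetSum _ fun x _ => continuous_const.mul ?_
    refine continuous_finsetProd _ fun X _ => ?_
    exact (continuous_apply (x X)).comp (continuous_subtype_val.comp
      ((continuous_apply (fun c : S.ctx X => x c)).comp (continuous_apply X)))
  exact (isCompact_range hc).isGreatest_sSup (Set.range_nonempty _)

/-- The value of information of the context `Z` for the decision `X`. -/
noncomputable def valueOfInformation (M : SCM V Y) (S : MixedPolicyScope V) (X Z : V) : ℝ :=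
  M.meu S - M.meu (S.removeContext X Z)

/-- The context `Z` is material for the decision `X`. -/
def Material (M : SCM V Y) (S : MixedPolicyScope V) (X Z : V) : Prop :=
  0 < M.valueOfInformation S X Z

end SCM

/-!
A model is built in which the outcome `Y` has two values, "accept" and "reject". Some policy that
uses the context `Z₀` makes `Y` accept for every value of the noise, whereas every policy that does
not use it makes `Y` reject for some value of the noise. As all values of the noise have positive
probability, this is materiality, and only deterministic policies matter (`gameSCM_material`).

*What the graph provides.* By the condition on policy nodes, a context `Z` that is not a decision
has an active path to `Y` given all other decisions and contexts. None of its vertices after `Z` is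
a decision, its non-colliders are not contexts, and each of its colliders is an ancestor of some
decision and thus of `Y`. A context that is itself a decision has, in turn, a context that is not a
decision and is seen by this decision only (`MixedPolicyScope.exists_sourceChain`).

*The game.* Let `u 0, ..., u n` be the values that are generated at the forks of the active path
of `Z₀`, or of a private context of `Z₀` if `Z₀` is a decision. The value `u 0` is a
number below `N`, and it is known to `Z₀`. The value `u (i + 1)` is a string of bits that is
indexed by the possible values of `u i`. The collider between two consecutive forks emits the single
bit of `u (i + 1)` at the position `u i`, and these bits are passed on to all descendants. The
outcome `Y` learns `u n` directly. The decision `X₀` has to claim the value of `u 0`, and the claim and the bits are relayed to `Y`, which accepts if the relayed bits are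
consistent with the claim and with `u n`. Wrong claims are caught. Suppose that all true bits are
`0`. Whatever bits are relayed along with a wrong claim, there are values of `u 1, ..., u n` that
nobody can tell from the actual ones, and for which they are inconsistent (`exists_not_explains`).
Bits are used because they are few. If `N` is large, then those that reach `X₀` cannot tell it the
value of `u 0`.

*Other decisions that know `Z₀`.* If other decisions lie on the directed path from `X₀` to `Y`, they
might know `u 0`, and correct the claim. This is prevented by a second chain of sources, whose
first value is the claim as made by `X₀`. Let `Z₁ → X₁` be the first edge into a decision on a
directed path from `X₀` to `Y`. If `Z₁ ≠ X₀`, then the active path of `Z₁` provides a string of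
bits from which a collider selects the bit at the position that `X₀` has claimed. If `X₀` claims a
wrong position, then no decision learns the bit at the right one (`exists_loss_of_direct`). If
`Z₁ = X₀`, then `X₀` has a private context. If this is `Z₀`, nobody knows `u 0` once it is removed
(`exists_loss_of_unseen`). Otherwise it shows `X₀` a string of `N` bits, and `X₀` has to select the
bit at the position `u 0`. As `X₀` has much fewer than `2 ^ N` values, it cannot pass on the string,
and leave the selection to others (`exists_loss_of_private`).
-/

/-! ### Systems of equations on a DAG -/

theorem IsDAG.wellFounded {V : Type*} [Finite V] {A : Digraph V} (hA : IsDAG A) :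
    WellFounded (Relation.TransGen A.Adj) := by
  have : IsTrans V (Relation.TransGen A.Adj) := ⟨fun _ _ _ => Relation.TransGen.trans⟩
  have : Std.Irrefl (Relation.TransGen A.Adj) := ⟨hA⟩
  exact Finite.wellFounded_of_trans_of_irrefl _

open scoped Classical in
/-- In a DAG on a finite vertex set, a system of equations in which the value of each vertex is
determined by the values of its parents has a solution. -/
theorem exists_solution_of_isDAG {V : Type*} [Finite V] {A : Digraph V} (hA : IsDAG A)
    {D : V → Type*} [∀ v, Nonempty (D v)] (F : ∀ v, (∀ w, D w) → D v)
    (hF : ∀ v x y, (∀ w, A.Adj w v → x w = y w) → F v x = F v y) :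
    ∃ x : ∀ v, D v, ∀ v, x v = F v x := by
  let x : ∀ v, D v := hA.wellFounded.fix fun v ih =>
    F v fun w => if h : Relation.TransGen A.Adj w v then ih w h else Classical.arbitrary _
  refine ⟨x, fun v => ?_⟩
  have hx : x v = F v fun w =>
      if h : Relation.TransGen A.Adj w v then x w else Classical.arbitrary _ := by
    simp only [x]
    rw [hA.wellFounded.fix_eq]
  rw [hx]
  exact hF v _ _ fun w hw => by rw [dif_pos (Relation.TransGen.single hw)]

theorem IsDAG.induction {V : Type*} [Finite V] {A : Digraph V} (hA : IsDAG A) {P : V → Prop}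
    (h : ∀ v, (∀ w, A.Adj w v → P w) → P v) (v : V) : P v := by
  exact hA.wellFounded.induction v fun v ih => h v fun w hw => ih w (.single hw)

/-! ### Games with deterministic policies -/

/-- A deterministic policy: every decision picks a value as a function of its contexts. -/
abbrev DetPolicy {V : Type*} (S : MixedPolicyScope V) (D : V → Type) : Type _ :=
  ∀ X : S.decisions, (∀ c : S.ctx X, D c) → D X

/-- The assignment `x` is an outcome of the game with mechanisms `mech`, noise `e` and deterministic
policy `σ`. -/
structure IsRun {V : Type*} {D : V → Type} (mech : ∀ v, (∀ w, D w) → D v → D v)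
    (S : MixedPolicyScope V) (σ : DetPolicy S D) (e x : ∀ v, D v) : Prop where
  mech_eq : ∀ v, v ∉ S.decisions → x v = mech v x (e v)
  policy_eq : ∀ X (hX : X ∈ S.decisions), x X = σ ⟨X, hX⟩ fun c => x c

theorem exists_isRun {V : Type*} [Finite V] {D : V → Type} [∀ v, Nonempty (D v)] {G : Digraph V}
    {mech : ∀ v, (∀ w, D w) → D v → D v}
    (hmech : ∀ v x y ε, (∀ w, G.Adj w v → x w = y w) → mech v x ε = mech v y ε)
    {S : MixedPolicyScope V} (hS : IsDAG (S.scopedGraph G)) (σ : DetPolicy S D) (e : ∀ v, D v) :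
    ∃ x, IsRun mech S σ e x := by
  classical
  obtain ⟨x, hx⟩ := exists_solution_of_isDAG hS
    (fun v x => if h : v ∈ S.decisions then σ ⟨v, h⟩ fun c => x c else mech v x (e v))
    (fun v x y hxy => by
      by_cases h : v ∈ S.decisions
      · simp only [h, dite_true]
        congr 1
        funext c
        exact hxy c (Or.inl ⟨h, c.2⟩)
      · simp only [h, dite_false]
        exact hmech v x y _ fun w hw => hxy w (Or.inr ⟨h, hw⟩))
  exact ⟨x, fun v hv => by rw [hx v, dif_neg hv], fun X hX => by rw [hx X, dif_pos hX]⟩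

section Game

universe v

variable {V : Type v} [Fintype V] {Y : V} {D : V → Type} [∀ v, Fintype (D v)] [∀ v, Nonempty (D v)]

open scoped Classical in
/-- The structural causal model of a game on a DAG `G`: every vertex has one uniformly distributed
private noise variable, with the same domain as the vertex itself. The mechanisms are given as
functions of a full assignment, of which only the values of the parents are passed on. -/
noncomputable def gameSCM (G : Digraph V) (hG : IsDAG G) (mech : ∀ v, (∀ w, D w) → D v → D v)
    (value : D Y → ℝ) (hvalue : Function.Injective value) : SCM V Y where
  U := V
  exoDom := D
  prob _ := ∏ v, (Fintype.card (D v) : ℝ)⁻¹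
  prob_nonneg _ := by positivity
  prob_sum := by
    rw [Finset.sum_const, Finset.card_univ, Fintype.card_pi, nsmul_eq_mul, Nat.cast_prod,
      ← Finset.prod_mul_distrib]
    exact Finset.prod_eq_one fun v _ => mul_inv_cancel₀ (by positivity)
  dom := D
  pa v := Finset.univ.filter fun w => G.Adj w v
  not_mem_pa v hv := hG v (.single (by simpa using hv))
  exo v := {v}
  f v p ε := mech v (fun w => if h : w ∈ Finset.univ.filter (fun w => G.Adj w v) then p ⟨w, h⟩
    else Classical.arbitrary _) (ε ⟨v, by simp⟩)
  value := value
  value_injective := hvalue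

variable {G : Digraph V} {hG : IsDAG G} {mech : ∀ v, (∀ w, D w) → D v → D v}
    {value : D Y → ℝ} {hvalue : Function.Injective value}

theorem gameSCM_prob_pos (e : ∀ v, D v) : 0 < (gameSCM G hG mech value hvalue).prob e := by
  change 0 < ∏ v, (Fintype.card (D v) : ℝ)⁻¹
  exact Finset.prod_pos fun v _ => by positivity

/-- The mechanisms of the model agree with the given ones, as these depend on parents only. -/
theorem gameSCM_f (hmech : ∀ v x y ε, (∀ w, G.Adj w v → x w = y w) → mech v x ε = mech v y ε)
    (v : V) (x : ∀ v, (gameSCM G hG mech value hvalue).dom v)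
    (e : ∀ i, (gameSCM G hG mech value hvalue).exoDom i) :
    (gameSCM G hG mech value hvalue).f v (fun w => x w) (fun i => e i) = mech v x (e v) := by
  refine hmech v _ _ _ fun w hw => ?_
  have hw' : w ∈ (gameSCM G hG mech value hvalue).pa v := by simpa [gameSCM] using hw
  exact dif_pos hw'

open scoped Classical in
/-- Independence of the coordinates under the uniform distribution on a product. -/
theorem sum_prod_inv_card_eq (b : ∀ v, D v) :
    (∑ e : ∀ v, D v, if ∀ v, e v = b v then ∏ v, (Fintype.card (D v) : ℝ)⁻¹ else 0) =
      ∏ v, ∑ e : ∀ v, D v, if e v = b v then ∏ v, (Fintype.card (D v) : ℝ)⁻¹ else 0 := by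
  simp only [← funext_iff]
  rw [Finset.sum_ite_eq' Finset.univ b, if_pos (Finset.mem_univ _)]
  refine Finset.prod_congr rfl fun v _ => ?_
  have h : ∀ e : ∀ v, D v, (if e v = b v then ∏ v, (Fintype.card (D v) : ℝ)⁻¹ else 0) =
      ∏ w, if w = v → e w = b w then (Fintype.card (D w) : ℝ)⁻¹ else 0 := by
    intro e
    by_cases h : e v = b v
    · rw [if_pos h]
      refine Finset.prod_congr rfl fun w _ => ?_
      rw [if_pos]
      rintro rfl
      exact h
    · rw [if_neg h]
      symm
      refine Finset.prod_eq_zero (Finset.mem_univ v) ?_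
      simp [h]
  simp only [h]
  rw [← Fintype.prod_sum (fun w (d : D w) =>
    if w = v → d = b w then (Fintype.card (D w) : ℝ)⁻¹ else 0)]
  rw [Finset.prod_eq_single_of_mem v (Finset.mem_univ v)]
  · simp
  · intro w _ hw
    simp only [hw, false_imp_iff, if_true, Finset.sum_const, Finset.card_univ, nsmul_eq_mul]
    exact mul_inv_cancel₀ (by positivity)

open scoped Classical in
theorem gameSCM_exoProb (E : (∀ v, D v) → Prop) :
    (gameSCM G hG mech value hvalue).exoProb E =
      ∑ e : ∀ v, D v, if E e then ∏ v, (Fintype.card (D v) : ℝ)⁻¹ else 0 := rfl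

theorem gameSCM_compatibleWith : (gameSCM G hG mech value hvalue).CompatibleWith G := by
  classical
  refine ⟨fun v w => by simp [gameSCM], fun a => ?_⟩
  -- Each vertex has a single noise variable, so `a` amounts to a full noise assignment `b`.
  let b : ∀ v, D v := fun v => a v ⟨v, Finset.mem_singleton_self v⟩
  have hb : ∀ v, (fun e : ∀ i, (gameSCM G hG mech value hvalue).exoDom i =>
      ∀ i : (gameSCM G hG mech value hvalue).exo v, e i = a v i) =
      fun e : ∀ i, D i => e v = b v := by
    refine fun v => funext fun e => propext ⟨fun h => h ⟨v, Finset.mem_singleton_self v⟩, ?_⟩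
    rintro h ⟨i, hi⟩
    obtain rfl : i = v := Finset.mem_singleton.mp hi
    exact h
  have hb' : (fun e : ∀ i, (gameSCM G hG mech value hvalue).exoDom i =>
      ∀ v, ∀ i : (gameSCM G hG mech value hvalue).exo v, e i = a v i) =
      fun e : ∀ i, D i => ∀ v, e v = b v :=
    funext fun e => propext (forall_congr' fun v => iff_of_eq (congrFun (hb v) e))
  rw [hb']
  simp only [hb]
  refine (gameSCM_exoProb _).trans (Eq.trans ?_ ((sum_prod_inv_card_eq b).trans
    (Finset.prod_congr rfl fun v _ => Eq.trans ?_ (gameSCM_exoProb fun e => e v = b v).symm)))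
  · congr!
  · congr!

theorem gameSCM_doProb_nonneg (E : Finset V) (x : ∀ v, D v) :
    0 ≤ (gameSCM G hG mech value hvalue).doProb E x := by
  classical
  unfold SCM.doProb
  refine Finset.sum_nonneg fun e _ => mul_nonneg (Finset.prod_nonneg fun v _ => ?_)
    (SCM.prob_nonneg _ e)
  split_ifs <;> norm_num

theorem gameSCM_doProb_pos
    (hmech : ∀ v x y ε, (∀ w, G.Adj w v → x w = y w) → mech v x ε = mech v y ε)
    {E : Finset V} {x e : ∀ v, D v} (h : ∀ v, v ∉ E → x v = mech v x (e v)) :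
    0 < (gameSCM G hG mech value hvalue).doProb E x := by
  classical
  unfold SCM.doProb
  refine Finset.sum_pos' (fun e _ => mul_nonneg (Finset.prod_nonneg fun v _ => ?_)
    (SCM.prob_nonneg _ e)) ⟨e, Finset.mem_univ _, mul_pos (Finset.prod_pos fun v hv => ?_)
    (gameSCM_prob_pos e)⟩
  · split_ifs <;> norm_num
  · rw [if_pos ((gameSCM_f hmech v x e).trans (h v (Finset.mem_filter.mp hv).2).symm)]
    norm_num

theorem exists_of_gameSCM_doProb_ne_zero
    (hmech : ∀ v x y ε, (∀ w, G.Adj w v → x w = y w) → mech v x ε = mech v y ε)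
    {E : Finset V} {x : ∀ v, D v} (h : (gameSCM G hG mech value hvalue).doProb E x ≠ 0) :
    ∃ e : ∀ v, D v, ∀ v, v ∉ E → x v = mech v x (e v) := by
  classical
  unfold SCM.doProb at h
  obtain ⟨e, -, he⟩ := Finset.exists_ne_zero_of_sum_ne_zero h
  refine ⟨e, fun v hv => ?_⟩
  have := Finset.prod_ne_zero_iff.mp (left_ne_zero_of_mul he) v (by simpa using hv)
  rw [ne_eq, ite_eq_right_iff, Classical.not_imp] at this
  exact this.1.symm.trans (gameSCM_f hmech v x e)

/-- To establish materiality it is enough to consider deterministic policies and outcomes that are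
certain: if the best outcome has value `0`, if some policy reaches it for every noise, and if every
policy that does not use the context misses it for some noise, then the context is material. Using
`0` for the best value makes it unnecessary to know that the probabilities add up to `1`. -/
theorem gameSCM_material
    (hmech : ∀ v x y ε, (∀ w, G.Adj w v → x w = y w) → mech v x ε = mech v y ε)
    (hneg : ∀ d, value d ≤ 0) {S : MixedPolicyScope V} {X Z : V}
    (σ : DetPolicy S D) (hσ : ∀ e x, IsRun mech S σ e x → value (x Y) = 0)
    (hlose : ∀ τ : DetPolicy (S.removeContext X Z) D,
      ∃ e x, IsRun mech (S.removeContext X Z) τ e x ∧ value (x Y) < 0) :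
    (gameSCM G hG mech value hvalue).Material S X Z := by
  classical
  set M := gameSCM G hG mech value hvalue with hM
  have h1 : 0 ≤ M.meu S := by
    let π : M.Policy S := fun X c => ⟨Pi.single (σ X c) 1, single_mem_stdSimplex ℝ _⟩
    have h0 : M.expectedUtility S π = 0 := by
      unfold SCM.expectedUtility
      refine Finset.sum_eq_zero fun x _ => ?_
      by_contra hne
      have hP := right_ne_zero_of_mul hne
      have hD := right_ne_zero_of_mul (left_ne_zero_of_mul hne)
      have hV := left_ne_zero_of_mul (left_ne_zero_of_mul hne)
      obtain ⟨e, he⟩ := exists_of_gameSCM_doProb_ne_zero hmech hD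
      refine hV (hσ e x ⟨he, fun X hX => ?_⟩)
      have := Finset.prod_ne_zero_iff.mp hP ⟨X, hX⟩ (Finset.mem_univ _)
      by_contra hx
      exact this (Pi.single_eq_of_ne hx 1)
    have := (M.isGreatest_meu S).2 ⟨π, rfl⟩
    rwa [h0] at this
  have h2 : M.meu (S.removeContext X Z) < 0 := by
    obtain ⟨π, hπ⟩ := (M.isGreatest_meu (S.removeContext X Z)).1
    rw [← hπ]
    -- A deterministic policy in the support of `π`.
    have hsupp : ∀ (X' : (S.removeContext X Z).decisions)
        (c : ∀ c : (S.removeContext X Z).ctx X', M.dom c), ∃ d, 0 < (π X' c).1 d := by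
      intro X' c
      by_contra! hle
      have h1 := (π X' c).2.2
      have h2 : ∑ d, (π X' c).1 d ≤ 0 := Finset.sum_nonpos fun d _ => hle d
      linarith
    choose τ hτ using hsupp
    obtain ⟨e, x, hx, hxY⟩ := hlose τ
    unfold SCM.expectedUtility
    refine Finset.sum_neg' (fun x _ => ?_) ⟨x, Finset.mem_univ _, ?_⟩
    · refine mul_nonpos_of_nonpos_of_nonneg
        (mul_nonpos_of_nonpos_of_nonneg (hneg _) (gameSCM_doProb_nonneg _ _))
        (Finset.prod_nonneg fun X' _ => (π X' _).2.1 _)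
    · refine mul_neg_of_neg_of_pos
        (mul_neg_of_neg_of_pos hxY (gameSCM_doProb_pos hmech hx.mech_eq))
        (Finset.prod_pos fun X' _ => ?_)
      have := hτ X' fun c => x c
      rwa [← hx.policy_eq X' X'.2] at this
  unfold SCM.Material SCM.valueOfInformation
  linarith

end Game

/-! ### Numbers as strings of bits -/

/-- The number of values that a source at height `i` of a chain of sources can take: the values at
height `i + 1` encode the strings of bits that are indexed by the values at height `i`. -/
def towerLevel (N : ℕ) : ℕ → ℕ
  | 0 => N
  | i + 1 => 2 ^ towerLevel N i

theorem towerLevel_pos {N : ℕ} (hN : 0 < N) : ∀ i, 0 < towerLevel N i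
  | 0 => hN
  | _ + 1 => Nat.two_pow_pos _

theorem exists_testBit_eq (L : ℕ) (g : ℕ → Bool) : ∃ m < 2 ^ L, ∀ s < L, m.testBit s = g s := by
  induction L with
  | zero => exact ⟨0, by simp, by simp⟩
  | succ L ih =>
    obtain ⟨m, hm, h⟩ := ih
    refine ⟨m + (g L).toNat * 2 ^ L, ?_, fun s hs => ?_⟩
    · have := Bool.toNat_le (g L)
      rw [pow_succ]
      nlinarith [Nat.two_pow_pos L]
    · cases hg : g L
      · rcases Nat.lt_succ_iff_lt_or_eq.mp hs with h1 | rfl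
        · simpa using h s h1
        · simp [Nat.testBit_lt_two_pow hm, hg]
      · rcases Nat.lt_succ_iff_lt_or_eq.mp hs with h1 | rfl
        · rw [← h s h1, Bool.toNat_true, one_mul, add_comm, Nat.testBit_two_pow_add_gt h1]
        · rw [Bool.toNat_true, one_mul, add_comm, Nat.testBit_two_pow_add_eq,
            Nat.testBit_lt_two_pow hm, hg, Bool.not_false]

/-- `Explains N κ ζ i v`: a value `v` at height `i` is consistent with the claims that the value at
height `0` is `ζ` and that, for each `j < i`, the value at height `j + 1` has the bit `κ j` at the
position that is given by the value at height `j`. -/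
def Explains (N : ℕ) (κ : ℕ → ℕ) (ζ : ℕ) : ℕ → ℕ → Prop
  | 0, v => v = ζ
  | i + 1, v => ∃ s < towerLevel N i, Explains N κ ζ i s ∧ (v.testBit s).toNat = κ i

theorem explains_of_forall {N : ℕ} {κ : ℕ → ℕ} {ζ : ℕ} {u : ℕ → ℕ} (h0 : u 0 = ζ) {n : ℕ}
    (hu : ∀ i < n, u i < towerLevel N i)
    (hκ : ∀ i < n, ((u (i + 1)).testBit (u i)).toNat = κ i) : Explains N κ ζ n (u n) := by
  induction n with
  | zero => exact h0
  | succ n ih =>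
    exact ⟨u n, hu n n.lt_succ_self, ih (fun i hi => hu i (hi.trans n.lt_succ_self))
      (fun i hi => hκ i (hi.trans n.lt_succ_self)), hκ n n.lt_succ_self⟩

/-- A value that does not explain the claims can be continued upwards by values that do not explain
them either, while the true bits all vanish: the string at the next height has the bit `0` at the
true position, and contradicts the claim at every other position. -/
theorem exists_not_explains {N : ℕ} {κ : ℕ → ℕ} {ζ a v : ℕ} (hv : v < towerLevel N a)
    (h : ¬ Explains N κ ζ a v) :
    ∃ w : ℕ → ℕ, w 0 = v ∧ ∀ j, w j < towerLevel N (a + j) ∧ ¬ Explains N κ ζ (a + j) (w j) ∧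
      (w (j + 1)).testBit (w j) = false := by
  have step : ∀ j s, ∃ m < towerLevel N (a + (j + 1)), m.testBit s = false ∧
      (s < towerLevel N (a + j) → ¬ Explains N κ ζ (a + j) s →
        ¬ Explains N κ ζ (a + (j + 1)) m) := by
    intro j s
    by_cases hs : s < towerLevel N (a + j)
    · obtain ⟨m, hm, hb⟩ := exists_testBit_eq (towerLevel N (a + j))
        (fun t => decide (t ≠ s ∧ κ (a + j) ≠ 1))
      refine ⟨m, hm, by rw [hb s hs]; simp, fun _ hns => ?_⟩
      rintro ⟨t, ht, hts, hbit⟩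
      have hne : t ≠ s := by
        rintro rfl
        exact hns hts
      rw [hb t ht] at hbit
      by_cases hκ : κ (a + j) = 1
      · simp [hκ] at hbit
      · simp only [hκ, hne, ne_eq, not_false_eq_true, and_self, decide_true,
          Bool.toNat_true] at hbit
        exact hκ hbit.symm
    · exact ⟨0, Nat.two_pow_pos _, by simp, fun h => absurd h hs⟩
  choose next hlt hbit hexp using step
  let w : ℕ → ℕ := fun j => Nat.rec v next j
  have hw : ∀ j, w j < towerLevel N (a + j) ∧ ¬ Explains N κ ζ (a + j) (w j) := by
    intro j
    induction j with
    | zero => exact ⟨hv, h⟩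
    | succ j ih => exact ⟨hlt j _, hexp j _ ih.1 ih.2⟩
  exact ⟨w, rfl, fun j => ⟨(hw j).1, (hw j).2, hbit j _⟩⟩

/-! ### The game -/

/-- The registers of a vertex. The first chain of sources is named `false`, the second one `true`.
For each chain `c` and each height `i` there is a register `hid c i` for the value of the source `i`
of the chain `c`, and a register `bit c i` for the bit of the source `i + 1` at the position that is
given by the source `i`. (The last register for bits of each chain is not used.) The register
`verdict` is for the decision of the outcome vertex, where `0` means acceptance. -/
inductive Register (n : Bool → ℕ)
  | verdict
  | hid (c : Bool) (i : Fin (n c + 1))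
  | bit (c : Bool) (i : Fin (n c + 1))
  deriving DecidableEq, Fintype

/-- The layout of a game on a graph `A` with decisions `dec`. Source `0` of the second chain is the
decision `X₀`, which claims a value for source `0` of the first chain. All other sources generate
their values from noise. The value of a source is passed on to carriers only, from parent to child,
whereas bits are passed on to all descendants. -/
structure Design {V : Type*} (A : Digraph V) (dec : Finset V) (X₀ Z₀ Y : V) where
  /-- The height of the last source of a chain. -/
  n : Bool → ℕ
  /-- The sources. -/
  U : Bool → ℕ → V
  /-- The vertices where bits are emitted: `K c i` emits the bit of the source `i + 1`, at the
  position that is given by the source `i`. -/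
  K : Bool → ℕ → V
  /-- The carriers to which the value of a source is passed on without the help of decisions. -/
  Tr : Bool → ℕ → Set V
  /-- The carriers of the value of a source. -/
  Car : Bool → ℕ → Set V
  U_true_zero : U true 0 = X₀
  U_mem : ∀ c i, i ≤ n c → U c i ∈ Tr c i
  U_not_dec : ∀ c i, i ≤ n c → U c i ∈ dec → c = true ∧ i = 0
  Tr_sub : ∀ c i, Tr c i ⊆ Car c i
  Tr_not_dec : ∀ c i v, v ∈ Tr c i → v ≠ U c i → v ∉ dec
  Tr_parent : ∀ c i v, v ∈ Tr c i → v ≠ U c i → ∃ w ∈ Tr c i, A.Adj w v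
  Car_ne_Y : ∀ c i, Y ∉ Car c i
  Car_parent : ∀ c i v, v ∈ Car c i → v ≠ U c i → ∃ w ∈ Car c i, A.Adj w v
  Car_nondec : ∀ c i v, v ∈ Car c i → v ∉ dec → (c = true ∧ i = 0) ∨ v ∈ Tr c i
  K_anc : ∀ c i, i < n c → IsAnc A (K c i) Y
  K_ne_Y : ∀ c i, i < n c → K c i ≠ Y
  K_parent : ∀ c i, i < n c → K c i ∉ dec →
    (∃ w ∈ Tr c i, A.Adj w (K c i)) ∧ ∃ w ∈ Tr c (i + 1), A.Adj w (K c i)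
  /-- The only decision that may have to emit a bit is `X₀`, which then selects the first bit of the
  second chain. -/
  K_dec : ∀ c i, i < n c → K c i ∈ dec →
    K c i = X₀ ∧ c = true ∧ i = 0 ∧ ∃ w ∈ Tr true 1, A.Adj w X₀
  Y_parent_false : ∃ w ∈ Tr false (n false), A.Adj w Y
  Y_parent : ∀ c, ∃ w ∈ Car c (n c), A.Adj w Y
  Y_parent_zero : ∃ w ∈ Car true 0, A.Adj w Y
  X₀_mem : X₀ ∈ dec
  Y_not_mem : Y ∉ dec
  Z₀_adj : A.Adj Z₀ X₀
  Z₀_mem : Z₀ ∈ Car false 0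
  X₀_Car : ∀ c i, X₀ ∈ Car c i → c = true ∧ i = 0
  Car_zero : ∀ v ∈ Car true 0, IsAnc A X₀ v

namespace Design

variable {V : Type*} {A : Digraph V} {dec : Finset V} {X₀ Z₀ Y : V}
  (d : Design A dec X₀ Z₀ Y)

/-- The register for the source `i` of the chain `c`, with a junk value if `i` is too large. -/
def h (c : Bool) (i : ℕ) : Register d.n := .hid c (Fin.ofNat _ i)

/-- The register for the bit `i` of the chain `c`, with a junk value if `i` is too large. -/
def b (c : Bool) (i : ℕ) : Register d.n := .bit c (Fin.ofNat _ i)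

open scoped Classical in
/-- The number of values of a register of a vertex. A vertex has no room for anything but the bits
and the values that it carries, and the outcome vertex has room for the verdict only. -/
noncomputable def cap (N : ℕ) (v : V) : Register d.n → ℕ
  | .verdict => if v = Y then 2 else 1
  | .hid c i => if v ∈ d.Car c i then towerLevel N i else 1
  | .bit _ _ => if v = Y then 1 else 2

theorem cap_pos {N : ℕ} (hN : 0 < N) (v : V) (t : Register d.n) : 0 < d.cap N v t := by
  cases t <;> simp only [cap] <;> split_ifs <;> first | exact towerLevel_pos hN _ | norm_num

open scoped Classical in
/-- The parent from which a vertex copies the value of the source `i` of the chain `c`. A parent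
that has learnt the value without the help of decisions is preferred. -/
noncomputable def par (c : Bool) (i : ℕ) (v : V) : V :=
  if h : ∃ w ∈ d.Tr c i, A.Adj w v then h.choose
  else if h : ∃ w ∈ d.Car c i, A.Adj w v then h.choose else v

theorem par_mem_Tr {c i v} (h : ∃ w ∈ d.Tr c i, A.Adj w v) :
    d.par c i v ∈ d.Tr c i ∧ A.Adj (d.par c i v) v := by
  rw [par, dif_pos h]
  exact h.choose_spec

theorem par_mem_Car {c i v} (h : ∃ w ∈ d.Car c i, A.Adj w v) :
    d.par c i v ∈ d.Car c i ∧ A.Adj (d.par c i v) v := by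
  by_cases h' : ∃ w ∈ d.Tr c i, A.Adj w v
  · exact ⟨d.Tr_sub c i (d.par_mem_Tr h').1, (d.par_mem_Tr h').2⟩
  · rw [par, dif_neg h', dif_pos h]
    exact h.choose_spec

open scoped Classical in
/-- The parent from which a vertex copies a bit: one to which the bit has been passed on. -/
noncomputable def bitPar (c : Bool) (i : ℕ) (v : V) : V :=
  if h : ∃ w, IsAnc A (d.K c i) w ∧ A.Adj w v then h.choose else v

theorem bitPar_spec {c i v} (h : ∃ w, IsAnc A (d.K c i) w ∧ A.Adj w v) :
    IsAnc A (d.K c i) (d.bitPar c i v) ∧ A.Adj (d.bitPar c i v) v := by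
  rw [bitPar, dif_pos h]
  exact h.choose_spec

/-- The outcome vertex accepts if, for both chains, the last source of the chain explains the bits
that have been passed on, relative to the claim that has been made about the first source of the
first chain. -/
def Accepts (N : ℕ) (y : V → Register d.n → ℕ) : Prop :=
  ∀ c, Explains N (fun i => y (d.bitPar c i Y) (d.b c i)) (y (d.par true 0 Y) (d.h true 0)) (d.n c)
    (y (d.par c (d.n c) Y) (d.h c (d.n c)))

open scoped Classical in
/-- The rule by which a vertex computes its registers from those of its parents, listed in `y`, and
from its noise `ε`. It is followed by the vertices that are not decisions, and also by the decisions
under the policy that is optimal if no context is removed, for which `X₀` takes its claim from `Z₀`. -/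
noncomputable def rule (N : ℕ) (v : V) (y : V → Register d.n → ℕ) (ε : Register d.n → ℕ) :
    Register d.n → ℕ
  | .verdict => if d.Accepts N y then 0 else 1
  | .hid c i =>
      if v = X₀ ∧ c = true ∧ i.val = 0 then y Z₀ (d.h false 0)
      else if v = d.U c i then ε (.hid c i) else y (d.par c i v) (.hid c i)
  | .bit c i =>
      if v = d.K c i ∧ i.val < d.n c then
        ((y (d.par c (i + 1) v) (d.h c (i + 1))).testBit
          (if v = X₀ then y Z₀ (d.h false 0) else y (d.par c i v) (d.h c i))).toNat
      else y (d.bitPar c i v) (.bit c i)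

open scoped Classical in
/-- The registers of the parents of `v`. -/
noncomputable def view (v : V) (y : V → Register d.n → ℕ) : V → Register d.n → ℕ :=
  fun w t => if A.Adj w v then y w t else 0

/-- The assignment `y` obeys the rule at the vertex `v`. -/
def Obeys (N : ℕ) (y : V → Register d.n → ℕ) (ε : V → Register d.n → ℕ) (v : V) : Prop :=
  ∀ t, y v t = d.rule N v (d.view v y) (ε v) t % d.cap N v t

variable {d} {N : ℕ} {y ε : V → Register d.n → ℕ}

theorem view_of_adj {v w : V} (h : A.Adj w v) (t : Register d.n) : d.view v y w t = y w t :=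
  if_pos h

theorem h_eq {c : Bool} {i : ℕ} (hi : i ≤ d.n c) : d.h c i = .hid c ⟨i, Nat.lt_succ_of_le hi⟩ := by
  unfold h
  congr 1
  exact Fin.ext (Nat.mod_eq_of_lt (Nat.lt_succ_of_le hi))

theorem b_eq {c : Bool} {i : ℕ} (hi : i ≤ d.n c) : d.b c i = .bit c ⟨i, Nat.lt_succ_of_le hi⟩ := by
  unfold b
  congr 1
  exact Fin.ext (Nat.mod_eq_of_lt (Nat.lt_succ_of_le hi))

theorem cap_h {c : Bool} {i : ℕ} (hi : i ≤ d.n c) {v : V} (hv : v ∈ d.Car c i) :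
    d.cap N v (d.h c i) = towerLevel N i := by
  rw [h_eq hi]
  exact if_pos hv

theorem h_eq_zero (hcap : ∀ v t, y v t < d.cap N v t) {c : Bool} {i : ℕ} (hi : i ≤ d.n c) {v : V}
    (hv : v ∉ d.Car c i) : y v (d.h c i) = 0 := by
  have := hcap v (d.h c i)
  rw [h_eq hi] at this ⊢
  simpa [cap, hv] using this

theorem h_lt (hcap : ∀ v t, y v t < d.cap N v t) {c : Bool} {i : ℕ} (hi : i ≤ d.n c) {v : V}
    (hv : v ∈ d.Car c i) : y v (d.h c i) < towerLevel N i :=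
  (cap_h hi hv) ▸ hcap v (d.h c i)

theorem bit_lt (hcap : ∀ v t, y v t < d.cap N v t) (c : Bool) (i : Fin (d.n c + 1)) (v : V) :
    y v (.bit c i) < 2 := by
  have := hcap v (.bit c i)
  simp only [cap] at this
  split_ifs at this <;> omega

/-- A carrier copies the value of a source from the chosen parent. -/
theorem Obeys.copy_h {v : V} (hO : d.Obeys N y ε v) (hcap : ∀ v t, y v t < d.cap N v t)
    {c : Bool} {i : ℕ} (hi : i ≤ d.n c)
    (hv : v ∈ d.Car c i) (hU : v ≠ d.U c i) :
    y v (d.h c i) = y (d.par c i v) (d.h c i) := by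
  have hp := d.par_mem_Car (d.Car_parent c i v hv hU)
  have h1 := hO (d.h c i)
  have hX : ¬ (v = X₀ ∧ c = true ∧ i = 0) := by
    rintro ⟨rfl, rfl, rfl⟩
    exact hU d.U_true_zero.symm
  rw [cap_h hi hv, h_eq hi] at h1
  simp only [rule, hX, if_false, if_neg hU] at h1
  rw [← h_eq hi, view_of_adj hp.2, Nat.mod_eq_of_lt (h_lt hcap hi hp.1)] at h1
  exact h1

theorem Obeys.source {v : V} (hO : d.Obeys N y ε v) {c : Bool} {i : ℕ} (hi : i ≤ d.n c)
    (hU : v = d.U c i) (hX : v ≠ X₀) : y v (d.h c i) = ε v (d.h c i) % towerLevel N i := by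
  have h1 := hO (d.h c i)
  rw [cap_h hi (d.Tr_sub c i (hU ▸ d.U_mem c i hi)), h_eq hi] at h1
  simp only [rule, hX, false_and, if_false, if_pos hU] at h1
  rw [h_eq hi]
  exact h1

theorem Obeys.bit_emit {v : V} (hO : d.Obeys N y ε v) {c : Bool} {i : ℕ} (hi : i < d.n c)
    (hK : v = d.K c i) (hX : v ≠ X₀) (h0 : ∃ w ∈ d.Tr c i, A.Adj w v)
    (h1 : ∃ w ∈ d.Tr c (i + 1), A.Adj w v) :
    y v (d.b c i) = ((y (d.par c (i + 1) v) (d.h c (i + 1))).testBit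
      (y (d.par c i v) (d.h c i))).toNat := by
  have h2 := hO (d.b c i)
  have hY : v ≠ Y := hK ▸ d.K_ne_Y c i hi
  rw [b_eq hi.le] at h2 ⊢
  simp only [rule, cap, if_pos (And.intro hK hi), if_neg hX, if_neg hY] at h2
  rw [view_of_adj (d.par_mem_Tr h0).2, view_of_adj (d.par_mem_Tr h1).2] at h2
  rw [h2]
  exact Nat.mod_eq_of_lt (Nat.lt_succ_of_le (Bool.toNat_le _))

theorem Obeys.bit_copy {v : V} (hO : d.Obeys N y ε v) (hcap : ∀ v t, y v t < d.cap N v t)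
    {c : Bool} {i : Fin (d.n c + 1)} (hY : v ≠ Y) (hK : ¬ (v = d.K c i ∧ i.val < d.n c)) :
    y v (.bit c i) = d.view v y (d.bitPar c i v) (.bit c i) := by
  have h2 := hO (.bit c i)
  simp only [rule, cap, if_neg hK, if_neg hY] at h2
  rw [h2]
  refine Nat.mod_eq_of_lt ?_
  unfold view
  split_ifs
  · exact bit_lt hcap c i _
  · norm_num

/-- The value of the source `i` of the chain `c`. -/
def truth (d : Design A dec X₀ Z₀ Y) (y : V → Register d.n → ℕ) (c : Bool) (i : ℕ) : ℕ :=
  y (d.U c i) (d.h c i)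

/-- Whatever the policy is, the vertices to which the value of a source is passed on without the
help of decisions know it. -/
theorem eq_truth [Finite V] (hA : IsDAG A) (hcap : ∀ v t, y v t < d.cap N v t)
    (hO : ∀ v, v ∉ dec → d.Obeys N y ε v) {c : Bool} {i : ℕ} (hi : i ≤ d.n c) (v : V) :
    v ∈ d.Tr c i → y v (d.h c i) = d.truth y c i := by
  refine hA.induction (P := fun v => v ∈ d.Tr c i → y v (d.h c i) = d.truth y c i)
    (fun v ih hv => ?_) v
  by_cases hU : v = d.U c i
  · rw [hU]
    rfl
  · rw [(hO v (d.Tr_not_dec c i v hv hU)).copy_h hcap hi (d.Tr_sub c i hv) hU]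
    have hp := d.par_mem_Tr (d.Tr_parent c i v hv hU)
    exact ih _ hp.2 hp.1

/-- If all vertices obey the rule, then the outcome vertex accepts. -/
theorem verdict_eq_zero [Finite V] (hA : IsDAG A) (hcap : ∀ v t, y v t < d.cap N v t)
    (hO : ∀ v, d.Obeys N y ε v) : y Y .verdict = 0 := by
  have hcar : ∀ c i, i ≤ d.n c → ∀ v, v ∈ d.Car c i → y v (d.h c i) = d.truth y c i := by
    intro c i hi v
    refine hA.induction (P := fun v => v ∈ d.Car c i → y v (d.h c i) = d.truth y c i)
      (fun v ih hv => ?_) v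
    by_cases hU : v = d.U c i
    · rw [hU]
      rfl
    · rw [(hO v).copy_h hcap hi hv hU]
      have hp := d.par_mem_Car (d.Car_parent c i v hv hU)
      exact ih _ hp.2 hp.1
  have hX0 : X₀ ∈ d.Tr true 0 := by
    simpa only [d.U_true_zero] using d.U_mem true 0 (Nat.zero_le _)
  -- The decision `X₀` passes on the value that it learns from `Z₀`.
  have hzero : d.truth y true 0 = d.truth y false 0 := by
    have h1 := hO X₀ (d.h true 0)
    rw [cap_h (Nat.zero_le _) (d.Tr_sub _ _ hX0), h_eq (Nat.zero_le _)] at h1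
    simp only [rule, and_self, if_true] at h1
    rw [view_of_adj d.Z₀_adj, hcar false 0 (Nat.zero_le _) Z₀ d.Z₀_mem, Nat.mod_eq_of_lt] at h1
    · rw [truth, d.U_true_zero, h_eq (Nat.zero_le _)]
      exact h1
    · rw [← hcar false 0 (Nat.zero_le _) Z₀ d.Z₀_mem]
      exact h_lt hcap (Nat.zero_le _) d.Z₀_mem
  -- The ancestors of `Y` suffice here: below `Y` the bits may get lost.
  have hbit : ∀ c i, i < d.n c → ∀ v, IsAnc A (d.K c i) v → IsAnc A v Y → v ≠ Y →
      y v (d.b c i) = ((d.truth y c (i + 1)).testBit (d.truth y c i)).toNat := by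
    intro c i hi v
    refine hA.induction (P := fun v => IsAnc A (d.K c i) v → IsAnc A v Y → v ≠ Y →
      y v (d.b c i) = ((d.truth y c (i + 1)).testBit (d.truth y c i)).toNat)
      (fun v ih hv hvY hne => ?_) v
    by_cases hK : v = d.K c i
    · by_cases hdec : d.K c i ∈ dec
      · obtain ⟨h1, rfl, rfl, h2⟩ := d.K_dec c i hi hdec
        have hvX : v = X₀ := hK.trans h1
        subst hvX
        have h3 := hO v (d.b true 0)
        rw [b_eq hi.le] at h3 ⊢
        simp only [rule, cap, if_pos (And.intro hK hi), if_true, if_neg hne] at h3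
        rw [view_of_adj d.Z₀_adj, view_of_adj (d.par_mem_Tr h2).2,
          hcar false 0 (Nat.zero_le _) Z₀ d.Z₀_mem,
          hcar true 1 hi _ (d.Tr_sub _ _ (d.par_mem_Tr h2).1), ← hzero] at h3
        rw [h3]
        exact Nat.mod_eq_of_lt (Nat.lt_succ_of_le (Bool.toNat_le _))
      · obtain ⟨h0, h1⟩ := d.K_parent c i hi hdec
        have hX : v ≠ X₀ := by
          intro h
          exact hdec (by rw [← hK, h]; exact d.X₀_mem)
        rw [← hK] at h0 h1
        rw [(hO v).bit_emit hi hK hX h0 h1,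
          hcar c (i + 1) hi _ (d.Tr_sub _ _ (d.par_mem_Tr h1).1),
          hcar c i hi.le _ (d.Tr_sub _ _ (d.par_mem_Tr h0).1)]
    · obtain ⟨w, hw, hwv⟩ : ∃ w, IsAnc A (d.K c i) w ∧ A.Adj w v := by
        rcases Relation.ReflTransGen.cases_tail hv with rfl | ⟨w, hw, hwv⟩
        · exact absurd rfl hK
        · exact ⟨w, hw, hwv⟩
      have hp := d.bitPar_spec ⟨w, hw, hwv⟩
      rw [b_eq hi.le, (hO v).bit_copy hcap hne (fun h => hK h.1), view_of_adj hp.2, ← b_eq hi.le]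
      refine ih _ hp.2 hp.1 (.head hp.2 hvY) fun h => ?_
      exact hA Y (.head' (h.symm ▸ hp.2) hvY)
  have hacc : d.Accepts N (d.view Y y) := by
    intro c
    have hp0 := d.par_mem_Car d.Y_parent_zero
    have hpc := d.par_mem_Car (d.Y_parent c)
    rw [view_of_adj hp0.2, view_of_adj hpc.2, hcar _ _ (Nat.zero_le _) _ hp0.1,
      hcar _ _ le_rfl _ hpc.1]
    refine explains_of_forall ?_ (fun i hi => ?_) fun i hi => ?_
    · cases c
      · exact hzero.symm
      · rfl
    · exact h_lt hcap hi.le (d.Tr_sub _ _ (d.U_mem c i hi.le))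
    · have hp : IsAnc A (d.K c i) (d.bitPar c i Y) ∧ A.Adj (d.bitPar c i Y) Y := by
        refine d.bitPar_spec ?_
        rcases Relation.ReflTransGen.cases_tail (d.K_anc c i hi) with h | ⟨w, hw, hwv⟩
        · exact absurd h.symm (d.K_ne_Y c i hi)
        · exact ⟨w, hw, hwv⟩
      rw [view_of_adj hp.2]
      refine (hbit c i hi _ hp.1 (.single hp.2) fun h => ?_).symm
      exact hA Y (.single (by simpa only [h] using hp.2))
  have h1 := hO Y .verdict
  simpa [rule, hacc] using h1

end Design

/-! ### Outcomes of the game -/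

namespace Design

section Play

variable {V : Type*} {G : Digraph V} {S : MixedPolicyScope V} {X₀ Z₀ Y : V}
  (d : Design (S.scopedGraph G) S.decisions X₀ Z₀ Y) (N : ℕ)

/-- The domain of a vertex: the assignments of values to its registers. -/
abbrev Val (v : V) : Type := ∀ t : Register d.n, Fin (d.cap N v t)

instance [NeZero N] (v : V) : Nonempty (d.Val N v) :=
  ⟨fun t => ⟨0, d.cap_pos (NeZero.pos N) v t⟩⟩

variable {d N}

/-- An assignment, as natural numbers. -/
abbrev nat (x : ∀ v, d.Val N v) : V → Register d.n → ℕ := fun v t => x v t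

theorem nat_lt (x : ∀ v, d.Val N v) (v : V) (t : Register d.n) : nat x v t < d.cap N v t :=
  (x v t).2

/-- The bits of the chain `c` that the outcome vertex is told. -/
noncomputable def toldBit (x : ∀ v, d.Val N v) (c : Bool) (i : ℕ) : ℕ :=
  d.view Y (nat x) (d.bitPar c i Y) (d.b c i)

/-- The first source value that the outcome vertex is told. -/
noncomputable def toldSource (x : ∀ v, d.Val N v) : ℕ :=
  d.view Y (nat x) (d.par true 0 Y) (d.h true 0)

theorem told_eq {x x' : ∀ v, d.Val N v}
    (h : ∀ v, (∀ c i, nat x v (.bit c i) = nat x' v (.bit c i)) ∧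
      nat x v (d.h true 0) = nat x' v (d.h true 0)) :
    toldBit x = toldBit x' ∧ toldSource x = toldSource x' := by
  constructor
  · funext c i
    unfold toldBit view
    split_ifs
    · exact (h _).1 c _
    · rfl
  · unfold toldSource view
    split_ifs
    · exact (h _).2
    · rfl

variable (d N) [NeZero N]

/-- The value that a vertex obtains from the rule. -/
noncomputable def ruleVal (v : V) (y : V → Register d.n → ℕ) (ε : Register d.n → ℕ) : d.Val N v :=
  fun t => ⟨d.rule N v y ε t % d.cap N v t, Nat.mod_lt _ (d.cap_pos (NeZero.pos N) v t)⟩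

open scoped Classical in
/-- The mechanisms: the rule for the vertices that are not decisions, and a constant for the
decisions, whose mechanisms are never used. -/
noncomputable def mech (v : V) (x : ∀ w, d.Val N w) (ε : d.Val N v) : d.Val N v :=
  if v ∈ S.decisions then Classical.arbitrary _
  else d.ruleVal N v (d.view v (nat x)) fun t => ε t

theorem mech_congr (v : V) (x y : ∀ w, d.Val N w) (ε : d.Val N v)
    (h : ∀ w, G.Adj w v → x w = y w) : d.mech N v x ε = d.mech N v y ε := by
  unfold mech
  split_ifs with hv
  · rfl
  · congr 1
    funext w t
    unfold view
    split_ifs with hw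
    · rcases hw with ⟨h1, -⟩ | ⟨-, h1⟩
      · exact absurd h1 hv
      · rw [nat, h w h1]
    · rfl

variable {d N}

theorem obeys_of_isRun {S' : MixedPolicyScope V} {σ : DetPolicy S' (d.Val N)}
    {e x : ∀ v, d.Val N v} (hx : IsRun (d.mech N) S' σ e x) (hS' : S'.decisions = S.decisions)
    {v : V} (hv : v ∉ S.decisions) : d.Obeys N (nat x) (nat e) v := by
  intro t
  rw [nat, hx.mech_eq v (hS' ▸ hv), mech, if_neg hv]
  rfl

variable (d N)

open scoped Classical in
/-- The policy under which all decisions obey the rule. -/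
noncomputable def honestPolicy : DetPolicy S (d.Val N) := fun X c =>
  d.ruleVal N X (fun w t => if h : w ∈ S.ctx X then c ⟨w, h⟩ t else 0) 0

variable {d N}

theorem verdict_eq_zero_of_isRun [Finite V] (hA : IsDAG (S.scopedGraph G)) {e x : ∀ v, d.Val N v}
    (hx : IsRun (d.mech N) S (d.honestPolicy N) e x) : (x Y .verdict : ℕ) = 0 := by
  classical
  refine verdict_eq_zero (ε := fun v => if v ∈ S.decisions then 0 else nat e v) hA (nat_lt x)
    fun v t => ?_
  by_cases hv : v ∈ S.decisions
  · rw [nat, hx.policy_eq v hv]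
    simp only [honestPolicy, ruleVal, if_pos hv]
    congr 2
    funext w t
    by_cases hw : w ∈ S.ctx v
    · have hadj : (S.scopedGraph G).Adj w v := Or.inl ⟨hv, hw⟩
      rw [dif_pos hw, view, if_pos hadj]
    · have : ¬ (S.scopedGraph G).Adj w v := by
        rintro (⟨-, h⟩ | ⟨h, -⟩)
        · exact hw h
        · exact h hv
      rw [dif_neg hw, view, if_neg this]
  · have h1 := obeys_of_isRun hx rfl hv t
    simpa only [if_neg hv] using h1

/-- The assignment `x` is an outcome of the policy `τ`, in which the sources take the values `u`.
(The first source of the second chain is the decision `X₀`, whose value depends on the policy.) -/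
def Play (τ : DetPolicy (S.removeContext X₀ Z₀) (d.Val N)) (u : Bool → ℕ → ℕ)
    (x : ∀ v, d.Val N v) : Prop :=
  ∃ e, IsRun (d.mech N) (S.removeContext X₀ Z₀) τ e x ∧
    ∀ c i, i ≤ d.n c → ¬ (c = true ∧ i = 0) → d.truth (nat x) c i = u c i

theorem mem_of_mem_removeContext {S : MixedPolicyScope V} {X₀ Z₀ X C : V}
    (h : C ∈ (S.removeContext X₀ Z₀).ctx X) : C ∈ S.ctx X ∧ (X = X₀ → C ≠ Z₀) := by
  classical
  by_cases hX : X = X₀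
  · subst hX
    have h' : C ∈ S.ctx X \ {Z₀} := by
      simpa [MixedPolicyScope.removeContext] using h
    simp only [Finset.mem_sdiff, Finset.mem_singleton] at h'
    exact ⟨h'.1, fun _ => h'.2⟩
  · exact ⟨by simpa [MixedPolicyScope.removeContext, hX] using h, fun h => absurd h hX⟩

theorem isDAG_removeContext (hA : IsDAG (S.scopedGraph G)) :
    IsDAG ((S.removeContext X₀ Z₀).scopedGraph G) := by
  refine fun v hv => hA v (Relation.TransGen.mono ?_ _ _ hv)
  rintro a b (⟨h1, h2⟩ | h)
  · exact Or.inl ⟨h1, (mem_of_mem_removeContext h2).1⟩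
  · exact Or.inr h

theorem exists_play [Finite V] (hA : IsDAG (S.scopedGraph G))
    (τ : DetPolicy (S.removeContext X₀ Z₀) (d.Val N)) {u : Bool → ℕ → ℕ}
    (hu : ∀ c i, u c i < towerLevel N i) : ∃ x, d.Play τ u x := by
  let e : ∀ v, d.Val N v := fun v t =>
    ⟨(match t with | .hid c i => u c i | _ => 0) % d.cap N v t,
      Nat.mod_lt _ (d.cap_pos (NeZero.pos N) v t)⟩
  obtain ⟨x, hx⟩ := exists_isRun (d.mech_congr N) (isDAG_removeContext hA) τ e
  refine ⟨x, e, hx, fun c i hi hci => ?_⟩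
  have hU : d.U c i ∉ S.decisions := fun h => hci (d.U_not_dec c i hi h)
  have hX : d.U c i ≠ X₀ := fun h => hU (by rw [h]; exact d.X₀_mem)
  rw [truth, (obeys_of_isRun hx rfl hU).source hi rfl hX]
  have : nat e (d.U c i) (d.h c i) = u c i := by
    have h1 := hu c i
    rw [← cap_h hi (d.Tr_sub c i (d.U_mem c i hi))] at h1
    rw [h_eq hi] at h1 ⊢
    exact Nat.mod_eq_of_lt h1
  rw [this, Nat.mod_eq_of_lt (hu c i)]

section Observation

variable {τ : DetPolicy (S.removeContext X₀ Z₀) (d.Val N)} {u u' : Bool → ℕ → ℕ}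
  {x x' : ∀ v, d.Val N v}

theorem Play.eq_truth [Finite V] (hA : IsDAG (S.scopedGraph G)) (hx : d.Play τ u x) {c : Bool} {i : ℕ}
    (hi : i ≤ d.n c) {v : V} (hv : v ∈ d.Tr c i) :
    nat x v (d.h c i) = d.truth (nat x) c i := by
  obtain ⟨e, hrun, -⟩ := hx
  exact Design.eq_truth hA (nat_lt x) (fun v hv => obeys_of_isRun hrun rfl hv) hi v hv

theorem Play.truth_eq (hx : d.Play τ u x) {c : Bool} {i : ℕ} (hi : i ≤ d.n c)
    (hci : ¬ (c = true ∧ i = 0)) : d.truth (nat x) c i = u c i := by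
  obtain ⟨e, -, h⟩ := hx
  exact h c i hi hci

/-- Two outcomes agree at a vertex if they agree in the registers for bits, in the register for the
claim of `X₀`, and in the sources whose values the vertex learns. -/
theorem Play.ext_at [Finite V] (hA : IsDAG (S.scopedGraph G)) (hx : d.Play τ u x) (hx' : d.Play τ u' x')
    {v : V} (hY : v ≠ Y) (hbit : ∀ c i, nat x v (.bit c i) = nat x' v (.bit c i))
    (h0 : nat x v (d.h true 0) = nat x' v (d.h true 0))
    (hu : ∀ c i, i ≤ d.n c → ¬ (c = true ∧ i = 0) → v ∈ d.Car c i →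
      v ∉ S.decisions ∧ u c i = u' c i) : x v = x' v := by
  funext t
  refine Fin.ext ?_
  match t with
  | .verdict =>
    have h1 := nat_lt x v .verdict
    have h2 := nat_lt x' v .verdict
    simp only [cap, if_neg hY, Nat.lt_one_iff] at h1 h2
    exact h1.trans h2.symm
  | .bit c i => exact hbit c i
  | .hid c ⟨i, hi⟩ =>
    have hi' : i ≤ d.n c := Nat.le_of_lt_succ hi
    change nat x v (.hid c ⟨i, hi⟩) = nat x' v (.hid c ⟨i, hi⟩)
    rw [← h_eq hi']
    by_cases hci : c = true ∧ i = 0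
    · obtain ⟨rfl, rfl⟩ := hci
      exact h0
    · by_cases hv : v ∈ d.Car c i
      · obtain ⟨hdec, hu⟩ := hu c i hi' hci hv
        have hT := (d.Car_nondec c i v hv hdec).resolve_left hci
        rw [hx.eq_truth hA hi' hT, hx'.eq_truth hA hi' hT, hx.truth_eq hi' hci,
          hx'.truth_eq hi' hci, hu]
      · rw [h_eq_zero (nat_lt x) hi' hv, h_eq_zero (nat_lt x') hi' hv]

/-- The bits that the colliders outside of the decisions emit all vanish, if the sources take the
values `u`, and the first source of the second chain takes the value `ζ`. -/
def BitsVanish (d : Design (S.scopedGraph G) S.decisions X₀ Z₀ Y) (u : Bool → ℕ → ℕ) (ζ : ℕ) :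
    Prop :=
  ∀ c i, i < d.n c → d.K c i ∉ S.decisions →
    (u c (i + 1)).testBit (if c = true ∧ i = 0 then ζ else u c i) = false

/-- Two outcomes of the same policy in which the bits of the colliders all vanish agree in what can
be observed, if each decision learns the same source values in both (or acts in the same way for
another reason). This is claimed on a set `Q` of vertices that contains all parents of its
members. -/
theorem Play.observation_eq [Finite V] (hA : IsDAG (S.scopedGraph G))
    (hYC : ∀ X ∈ S.decisions, Y ∉ S.ctx X)
    (hx : d.Play τ u x) (hx' : d.Play τ u' x')
    {Q : Set V} (hQ : ∀ v ∈ Q, ∀ w, (S.scopedGraph G).Adj w v → w ∈ Q)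
    (hu : d.BitsVanish u (d.truth (nat x) true 0)) (hu' : d.BitsVanish u' (d.truth (nat x) true 0))
    (hdec : ∀ X ∈ S.decisions, X ∈ Q → x X = x' X ∨
      ∀ C ∈ (S.removeContext X₀ Z₀).ctx X, ∀ c i, i ≤ d.n c → ¬ (c = true ∧ i = 0) →
        C ∈ d.Car c i → u c i = u' c i)
    (v : V) (hv : v ∈ Q) :
    (∀ c i, nat x v (.bit c i) = nat x' v (.bit c i)) ∧
      nat x v (d.h true 0) = nat x' v (d.h true 0) ∧ (v ∈ S.decisions → x v = x' v) := by
  revert hv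
  refine hA.induction (P := fun v => v ∈ Q → (∀ c i, nat x v (.bit c i) = nat x' v (.bit c i)) ∧
      nat x v (d.h true 0) = nat x' v (d.h true 0) ∧ (v ∈ S.decisions → x v = x' v))
      (fun v ih hv => ?_) v
  by_cases hvd : v ∈ S.decisions
  · have key : x v = x' v := by
      rcases hdec v hvd hv with h | h
      · exact h
      · have hx2 := hx
        have hx2' := hx'
        obtain ⟨e, hrun, -⟩ := hx2
        obtain ⟨e', hrun', -⟩ := hx2'
        rw [hrun.policy_eq v hvd, hrun'.policy_eq v hvd]
        congr 1
        funext ⟨C, hC⟩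
        have hCS := (mem_of_mem_removeContext hC).1
        have hadj : (S.scopedGraph G).Adj C v := Or.inl ⟨hvd, hCS⟩
        have ihC := ih C hadj (hQ v hv C hadj)
        by_cases hCd : C ∈ S.decisions
        · exact ihC.2.2 hCd
        · refine hx.ext_at hA hx' (fun h => hYC v hvd (h ▸ hCS)) ihC.1 ihC.2.1 ?_
          exact fun c i hi hci hCar => ⟨hCd, h C hC c i hi hci hCar⟩
    refine ⟨fun c i => ?_, ?_, fun _ => key⟩
    · simp only [nat, key]
    · simp only [nat, key]
  · have hO : d.Obeys N (nat x) _ v := obeys_of_isRun hx.choose_spec.1 rfl hvd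
    have hO' : d.Obeys N (nat x') _ v := obeys_of_isRun hx'.choose_spec.1 rfl hvd
    refine ⟨fun c i => ?_, ?_, fun h => absurd h hvd⟩
    · by_cases hY : v = Y
      · have h1 := nat_lt x v (.bit c i)
        have h2 := nat_lt x' v (.bit c i)
        simp only [cap, if_pos hY, Nat.lt_one_iff] at h1 h2
        exact h1.trans h2.symm
      by_cases hK : v = d.K c i ∧ i.val < d.n c
      · obtain ⟨hK, hi⟩ := hK
        have hX : v ≠ X₀ := fun h => hvd (h ▸ d.X₀_mem)
        obtain ⟨h0, h1⟩ := d.K_parent c i hi (hK ▸ hvd)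
        have hz := hu c i hi (hK ▸ hvd)
        have hz' := hu' c i hi (hK ▸ hvd)
        rw [← hK] at h0 h1
        have hb : d.b c i = .bit c i := b_eq hi.le
        rw [← hb, hO.bit_emit hi hK hX h0 h1, hO'.bit_emit hi hK hX h0 h1]
        have p0 := d.par_mem_Tr h0
        have p1 := d.par_mem_Tr h1
        have hne : ¬ (c = true ∧ i.val + 1 = 0) := by simp
        rw [hx.eq_truth hA hi p1.1, hx'.eq_truth hA hi p1.1, hx.truth_eq hi hne,
          hx'.truth_eq hi hne]
        by_cases hci : c = true ∧ i.val = 0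
        · rw [if_pos hci] at hz hz'
          obtain ⟨rfl, hi0⟩ := hci
          have ihp := (ih _ p0.2 (hQ v hv _ p0.2)).2.1
          have ht := hx.eq_truth hA hi.le p0.1
          rw [hi0] at ht ihp hz hz' ⊢
          rw [← ihp, ht, hz, hz']
        · rw [if_neg hci] at hz hz'
          rw [hx.eq_truth hA hi.le p0.1, hx'.eq_truth hA hi.le p0.1, hx.truth_eq hi.le hci,
            hx'.truth_eq hi.le hci, hz, hz']
      · rw [hO.bit_copy (nat_lt x) hY hK, hO'.bit_copy (nat_lt x') hY hK]
        unfold view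
        split_ifs with hw
        · exact (ih _ hw (hQ v hv _ hw)).1 c i
        · rfl
    · by_cases hC : v ∈ d.Car true 0
      · have hU : v ≠ d.U true 0 := by
          rw [d.U_true_zero]
          exact fun h => hvd (h ▸ d.X₀_mem)
        have hw := (d.par_mem_Car (d.Car_parent true 0 v hC hU)).2
        rw [hO.copy_h (nat_lt x) (Nat.zero_le _) hC hU,
          hO'.copy_h (nat_lt x') (Nat.zero_le _) hC hU]
        exact (ih _ hw (hQ v hv _ hw)).2.1
      · rw [h_eq_zero (nat_lt x) (Nat.zero_le _) hC, h_eq_zero (nat_lt x') (Nat.zero_le _) hC]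

/-- If, in some outcome of the policy, the value of the source `a` of the chain `c` does not explain
what the outcome vertex is told, then the policy loses for some noise: the values of the sources
above `a` may be such that nobody notices a difference, but that the last one of them does not
explain what the outcome vertex is told. -/
theorem Play.exists_loss [Finite V] (hA : IsDAG (S.scopedGraph G)) (hYC : ∀ X ∈ S.decisions, Y ∉ S.ctx X)
    (hx : d.Play τ u x) (hlt : ∀ c i, u c i < towerLevel N i)
    (hu : d.BitsVanish u (d.truth (nat x) true 0)) {c : Bool} {a : ℕ} (ha : a ≤ d.n c)
    (hY : ∃ w ∈ d.Tr c (d.n c), (S.scopedGraph G).Adj w Y)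
    (hseen : ∀ X ∈ S.decisions, ∀ C ∈ (S.removeContext X₀ Z₀).ctx X, ∀ i, a < i → i ≤ d.n c →
      C ∉ d.Car c i)
    (hex : ¬ Explains N (toldBit x c) (toldSource x) a (d.truth (nat x) c a)) :
    ∃ e x', IsRun (d.mech N) (S.removeContext X₀ Z₀) τ e x' ∧ (x' Y .verdict : ℕ) = 1 := by
  have hta : d.truth (nat x) c a < towerLevel N a :=
    h_lt (nat_lt x) ha (d.Tr_sub c a (d.U_mem c a ha))
  obtain ⟨w, hw0, hw⟩ := exists_not_explains hta hex
  -- The sources of the chain `c` above `a` are replaced by `w`.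
  let u' : Bool → ℕ → ℕ := fun c' i => if c' = c ∧ a < i then w (i - a) else u c' i
  have hu'lt : ∀ c i, u' c i < towerLevel N i := by
    intro c' i
    simp only [u']
    split_ifs with h
    · have := (hw (i - a)).1
      rwa [Nat.add_sub_cancel' h.2.le] at this
    · exact hlt c' i
  obtain ⟨x', hx'⟩ := exists_play hA τ hu'lt
  have hu' : d.BitsVanish u' (d.truth (nat x) true 0) := by
    intro c' i hi hK
    by_cases hc : c' = c ∧ a ≤ i
    · obtain ⟨rfl, hai⟩ := hc
      have h1 : u' c' (i + 1) = w (i - a + 1) := by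
        simp only [u', true_and]
        rw [if_pos (Nat.lt_succ_of_le hai), Nat.sub_add_comm hai]
      have h2 : (if c' = true ∧ i = 0 then d.truth (nat x) true 0 else u' c' i) = w (i - a) := by
        rcases hai.eq_or_lt with rfl | hlt'
        · rw [Nat.sub_self, hw0]
          split_ifs with h
          · rw [h.1, h.2]
          · simp only [u', lt_irrefl, and_false, if_false]
            exact (hx.truth_eq ha h).symm
        · rw [if_neg (by omega)]
          simp only [u', hlt', and_self, if_true]
      rw [h1, h2]
      exact (hw (i - a)).2.2
    · have h1 : u' c' (i + 1) = u c' (i + 1) := if_neg fun h => hc ⟨h.1, Nat.le_of_lt_succ h.2⟩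
      have h2 : u' c' i = u c' i := if_neg fun h => hc ⟨h.1, h.2.le⟩
      rw [h1, h2]
      exact hu c' i hi hK
  have hobs := hx.observation_eq hA hYC hx' (Q := Set.univ) (fun _ _ _ _ => trivial) hu hu'
    (fun X hX _ => Or.inr fun C hC c' i hi hci hCar => by
      refine (if_neg ?_).symm
      rintro ⟨rfl, hai⟩
      exact hseen X hX C hC i hai hi hCar)
  have htold := told_eq (fun v => ⟨(hobs v trivial).1, (hobs v trivial).2.1⟩)
  have hlast : d.truth (nat x') c (d.n c) = w (d.n c - a) := by
    by_cases hc : c = true ∧ d.n c = 0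
    · have ha0 : a = 0 := by omega
      have h0 : d.truth (nat x') c (d.n c) = d.truth (nat x) c a := by
        rw [ha0, hc.2, hc.1]
        exact ((hobs _ trivial).2.1).symm
      rw [h0, hc.2, Nat.zero_sub, hw0]
    · rw [hx'.truth_eq le_rfl hc]
      rcases ha.eq_or_lt with h | h
      · rw [← h, Nat.sub_self, hw0, h]
        rw [← h] at hc
        rw [← h, hx.truth_eq ha hc]
        simp [u']
      · simp [u', h]
  obtain ⟨e, hrun, -⟩ := id hx'
  refine ⟨e, x', hrun, ?_⟩
  have hYd : Y ∉ S.decisions := d.Y_not_mem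
  have hacc : ¬ d.Accepts N (d.view Y (nat x')) := by
    intro hacc
    have h1 := hacc c
    have hp := d.par_mem_Tr hY
    rw [view_of_adj hp.2, hx'.eq_truth hA le_rfl hp.1, hlast] at h1
    change Explains N (toldBit x' c) (toldSource x') (d.n c) (w (d.n c - a)) at h1
    rw [← htold.1, ← htold.2] at h1
    have h2 := (hw (d.n c - a)).2.1
    rw [Nat.add_sub_cancel' ha] at h2
    exact h2 h1
  have h1 := obeys_of_isRun hrun rfl hYd .verdict
  simpa [rule, hacc, cap] using h1

end Observation

/-- The reduction of materiality to the existence of a loss for every policy that does not use the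
context `Z₀`. -/
theorem exists_material [Fintype V] (hG : IsDAG G) (hA : IsDAG (S.scopedGraph G))
    (hloss : ∀ τ : DetPolicy (S.removeContext X₀ Z₀) (d.Val N),
      ∃ e x, IsRun (d.mech N) (S.removeContext X₀ Z₀) τ e x ∧ (x Y .verdict : ℕ) = 1) :
    ∃ M : SCM V Y, M.CompatibleWith G ∧ M.Material S X₀ Z₀ := by
  have hinj : Function.Injective fun q : d.Val N Y => -(((q .verdict : ℕ) : ℝ)) := by
    intro q r hqr
    funext t
    refine Fin.ext ?_
    have h1 := (q t).2
    have h2 := (r t).2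
    match t with
    | .verdict => exact_mod_cast neg_injective hqr
    | .hid c i =>
      simp only [cap, d.Car_ne_Y, if_false, Nat.lt_one_iff] at h1 h2
      exact h1.trans h2.symm
    | .bit c i =>
      simp only [cap, if_true, Nat.lt_one_iff] at h1 h2
      exact h1.trans h2.symm
  refine ⟨gameSCM G hG (d.mech N) _ hinj, gameSCM_compatibleWith,
    gameSCM_material (d.mech_congr N) (fun q => by simp) (d.honestPolicy N) (fun e x hx => ?_)
      fun τ => ?_⟩
  · simpa using verdict_eq_zero_of_isRun hA hx
  · obtain ⟨e, x, hx, h⟩ := hloss τ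
    exact ⟨e, x, hx, by simp [h]⟩

end Play

end Design

/-! ### Losses of the policies that do not use the context -/

namespace Design

variable {V : Type*} {G : Digraph V} {S : MixedPolicyScope V} {X₀ Z₀ Y : V}
  {d : Design (S.scopedGraph G) S.decisions X₀ Z₀ Y} {N : ℕ}

/-- The bits that are shown by the vertices. -/
def shownBits (x : ∀ v, d.Val N v) : V → Register d.n → Fin 2 := fun v t =>
  match t with
  | .bit c i => ⟨nat x v (.bit c i), bit_lt (nat_lt x) c i v⟩
  | _ => 0

theorem eq_of_shownBits_eq {x x' : ∀ v, d.Val N v} (h : shownBits x = shownBits x') (v : V) (c : Bool)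
    (i : Fin (d.n c + 1)) : nat x v (.bit c i) = nat x' v (.bit c i) := by
  have h1 : (shownBits x v (.bit c i) : ℕ) = shownBits x' v (.bit c i) := by rw [h]
  exact h1

/-- The number of values that `X₀` can take. -/
theorem card_val_le (hY : X₀ ≠ Y) :
    Fintype.card (d.Val N X₀) ≤ N * 2 ^ Fintype.card (Register d.n) := by
  let F : d.Val N X₀ → Fin N × (Register d.n → Fin 2) := fun q =>
    (⟨(q (d.h true 0) : ℕ), by
      have h : X₀ ∈ d.Car true 0 := by
        have := d.U_mem true 0 (Nat.zero_le _)
        rw [d.U_true_zero] at this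
        exact d.Tr_sub _ _ this
      exact lt_of_lt_of_eq (q (d.h true 0)).2 (cap_h (Nat.zero_le _) h)⟩,
    fun t => ⟨(q t : ℕ) % 2, Nat.mod_lt _ two_pos⟩)
  have hF : Function.Injective F := by
    intro q r hqr
    have h1 : (q (d.h true 0) : ℕ) = r (d.h true 0) := congrArg (fun p => (p.1 : ℕ)) hqr
    have h2 : ∀ t, (q t : ℕ) % 2 = (r t : ℕ) % 2 := fun t =>
      congrArg Fin.val (congrFun (congrArg Prod.snd hqr) t)
    funext t
    refine Fin.ext ?_
    have hq := (q t).2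
    have hr := (r t).2
    have h2 := h2 t
    match t with
    | .verdict =>
      simp only [cap, if_neg hY] at hq hr
      omega
    | .bit c i =>
      simp only [cap, if_neg hY] at hq hr
      omega
    | .hid c ⟨i, hi⟩ =>
      by_cases hX : X₀ ∈ d.Car c i
      · obtain ⟨rfl, rfl⟩ := d.X₀_Car c i hX
        rw [h_eq (Nat.zero_le _)] at h1
        exact h1
      · simp only [cap, if_neg hX] at hq hr
        omega
  simpa using Fintype.card_le_of_injective F hF

/-- The values of the sources in which only the first source of the first chain, with the value `z`,
and the second source of the second chain, with the value `w`, do not vanish. -/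
def sources (z w : ℕ) : Bool → ℕ → ℕ
  | false, 0 => z
  | true, 1 => w
  | _, _ => 0

theorem bitsVanish_sources {z w ζ : ℕ} (h : w = 0 ∨ d.K true 0 ∈ S.decisions) :
    d.BitsVanish (sources z w) ζ := by
  intro c i hi hK
  match c, i with
  | false, i => simp [sources]
  | true, i + 1 => simp [sources]
  | true, 0 => simp [sources, h.resolve_right hK]

variable [NeZero N]

section Context

variable {τ : DetPolicy (S.removeContext X₀ Z₀) (d.Val N)} {u u' : Bool → ℕ → ℕ}
  {x x' : ∀ v, d.Val N v}

/-- The decision `X₀` acts in the same way if its remaining contexts show the same bits, and the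
same source values. -/
theorem Play.eq_at_decision [Finite V] (hA : IsDAG (S.scopedGraph G))
    (hYC : ∀ X ∈ S.decisions, Y ∉ S.ctx X) (hx : d.Play τ u x) (hx' : d.Play τ u' x')
    (hbit : ∀ C ∈ S.ctx X₀, C ≠ Z₀ → ∀ c i, nat x C (.bit c i) = nat x' C (.bit c i))
    (hu : ∀ C ∈ S.ctx X₀, C ≠ Z₀ → ∀ c i, i ≤ d.n c → ¬ (c = true ∧ i = 0) → C ∈ d.Car c i →
      C ∉ S.decisions ∧ u c i = u' c i) : x X₀ = x' X₀ := by
  obtain ⟨e, hrun, -⟩ := id hx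
  obtain ⟨e', hrun', -⟩ := id hx'
  rw [hrun.policy_eq X₀ d.X₀_mem, hrun'.policy_eq X₀ d.X₀_mem]
  congr 1
  funext ⟨C, hC⟩
  obtain ⟨hC, hCZ⟩ := mem_of_mem_removeContext hC
  have hCZ := hCZ rfl
  -- The claim of `X₀` is not passed on to the contexts of `X₀`.
  have h0 : C ∉ d.Car true 0 := fun h =>
    hA X₀ (.tail' (d.Car_zero C h) (Or.inl ⟨d.X₀_mem, hC⟩))
  refine hx.ext_at hA hx' (fun h => hYC X₀ d.X₀_mem (h ▸ hC)) (hbit C hC hCZ) ?_ (hu C hC hCZ)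
  rw [h_eq_zero (nat_lt x) (Nat.zero_le _) h0, h_eq_zero (nat_lt x') (Nat.zero_le _) h0]

end Context

theorem sources_lt {z w : ℕ} (hz : z < N) (hw : w < 2 ^ N) (c : Bool) (i : ℕ) :
    sources z w c i < towerLevel N i := by
  unfold sources
  split
  · exact hz
  · exact hw
  · exact towerLevel_pos (NeZero.pos N) i

/-- The case of a claim that reaches the first collider of the second chain, or the outcome vertex,
without the help of decisions. There are too few bits to tell `X₀` the value of the first source of
the first chain, so that `X₀` claims a wrong value for some value of this source. Then the other
decisions cannot know the bit of the next source at the right position. -/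
theorem exists_loss_of_direct [Fintype V] (hA : IsDAG (S.scopedGraph G))
    (hYC : ∀ X ∈ S.decisions, Y ∉ S.ctx X)
    (hN : (2 ^ Fintype.card (Register d.n)) ^ Fintype.card V < N)
    (hctx : ∀ X ∈ S.decisions, ∀ C ∈ S.ctx X, ∀ c i, i ≤ d.n c → C ∈ d.Car c i → i = 0)
    (hctx₀ : ∀ C ∈ S.ctx X₀, C ≠ Z₀ → C ∉ d.Car false 0)
    (hY : ∃ w ∈ d.Tr true (d.n true), (S.scopedGraph G).Adj w Y)
    (τ : DetPolicy (S.removeContext X₀ Z₀) (d.Val N)) :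
    ∃ e x, IsRun (d.mech N) (S.removeContext X₀ Z₀) τ e x ∧ (x Y .verdict : ℕ) = 1 := by
  classical
  have hlt : ∀ z : Fin N, ∀ c i, sources z 0 c i < towerLevel N i := fun z =>
    sources_lt z.2 (Nat.two_pow_pos _)
  choose x hx using fun z : Fin N => exists_play hA τ (hlt z)
  obtain ⟨z₁, z₂, hne, hz⟩ : ∃ z₁ z₂, z₁ ≠ z₂ ∧ shownBits (x z₁) = shownBits (x z₂) :=
    Fintype.exists_ne_map_eq_of_card_lt _ (by simpa using hN)
  have heq : x z₁ X₀ = x z₂ X₀ := by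
    refine (hx z₁).eq_at_decision hA hYC (hx z₂) (fun C _ _ => eq_of_shownBits_eq hz C) ?_
    intro C hC hCZ c i hi hci hCar
    have hi0 := hctx X₀ d.X₀_mem C hC c i hi hCar
    have hc : c = false := by
      cases c
      · rfl
      · exact absurd ⟨rfl, hi0⟩ hci
    rw [hc, hi0] at hCar
    exact absurd hCar (hctx₀ C hC hCZ)
  obtain ⟨z, hz⟩ : ∃ z, d.truth (nat (x z)) true 0 ≠ z := by
    by_contra! h
    apply hne
    apply Fin.ext
    rw [← h z₁, ← h z₂, truth, truth, d.U_true_zero, nat, nat, heq]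
  have hseen : ∀ c, ∀ X ∈ S.decisions, ∀ C ∈ (S.removeContext X₀ Z₀).ctx X, ∀ i, 0 < i →
      i ≤ d.n c → C ∉ d.Car c i := fun c X hX C hC i hi0 hi hCar =>
    hi0.ne' (hctx X hX C (mem_of_mem_removeContext hC).1 c i hi hCar)
  by_cases hζ : toldSource (x z) = z
  · refine (hx z).exists_loss hA hYC (hlt z) (bitsVanish_sources (Or.inl rfl)) (c := true)
      (Nat.zero_le _) hY (hseen true) fun h => hz ?_
    exact Eq.trans h hζ
  · refine (hx z).exists_loss hA hYC (hlt z) (bitsVanish_sources (Or.inl rfl)) (c := false)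
      (Nat.zero_le _) d.Y_parent_false (hseen false) fun h => hζ ?_
    rw [(hx z).truth_eq (Nat.zero_le _) (by simp)] at h
    exact Eq.symm h

/-- The case of a context `Z₀` that is a context of no decision but `X₀`: once it is removed, no
decision learns the value of any source. -/
theorem exists_loss_of_unseen [Finite V] (hA : IsDAG (S.scopedGraph G))
    (hYC : ∀ X ∈ S.decisions, Y ∉ S.ctx X) (hN : 2 ≤ N)
    (hctx : ∀ X ∈ S.decisions, ∀ C ∈ (S.removeContext X₀ Z₀).ctx X, ∀ c i, i ≤ d.n c →
      ¬ (c = true ∧ i = 0) → C ∉ d.Car c i)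
    (τ : DetPolicy (S.removeContext X₀ Z₀) (d.Val N)) :
    ∃ e x, IsRun (d.mech N) (S.removeContext X₀ Z₀) τ e x ∧ (x Y .verdict : ℕ) = 1 := by
  have hlt : ∀ z : Fin N, ∀ c i, sources z 0 c i < towerLevel N i := fun z =>
    sources_lt z.2 (Nat.two_pow_pos _)
  choose x hx using fun z : Fin N => exists_play hA τ (hlt z)
  have htold : ∀ z z', toldSource (x z) = toldSource (x z') := by
    intro z z'
    have := (hx z).observation_eq hA hYC (hx z') (Q := Set.univ) (fun _ _ _ _ => trivial)
      (bitsVanish_sources (Or.inl rfl)) (bitsVanish_sources (Or.inl rfl))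
      (fun X hX _ => Or.inr fun C hC c i hi hci hCar => absurd hCar (hctx X hX C hC c i hi hci))
    exact (told_eq fun v => ⟨(this v trivial).1, (this v trivial).2.1⟩).2
  obtain ⟨z, hz⟩ : ∃ z, toldSource (x z) ≠ z := by
    by_contra! h
    have := (h ⟨0, by omega⟩).symm.trans ((htold _ _).trans (h ⟨1, by omega⟩))
    simp at this
  refine (hx z).exists_loss hA hYC (hlt z) (bitsVanish_sources (Or.inl rfl)) (c := false)
    (Nat.zero_le _) d.Y_parent_false
    (fun X hX C hC i hi0 hi => hctx X hX C hC false i hi (by simp)) fun h => hz ?_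
  rw [(hx z).truth_eq (Nat.zero_le _) (by simp)] at h
  exact Eq.symm h

/-- The case of a decision `X₀` that also has a context, other than `Z₀`, that is seen by no other
decision, and that shows a long string of bits. The decision `X₀` should pass on one bit of it, at
the position that is known from `Z₀`. Without `Z₀`, it would have to pass on as many bits as there
are positions that it cannot tell from each other, and these are more than it has room for. -/
theorem exists_loss_of_private [Fintype V] (hA : IsDAG (S.scopedGraph G))
    (hYC : ∀ X ∈ S.decisions, Y ∉ S.ctx X) {q : ℕ}
    (hNq : N = (2 ^ Fintype.card (Register d.n)) ^ Fintype.card V * q)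
    (hq : N * 2 ^ Fintype.card (Register d.n) < 2 ^ q)
    (hctx : ∀ X ∈ S.decisions, X ≠ X₀ → ∀ C ∈ S.ctx X, ∀ c i, i ≤ d.n c → C ∈ d.Car c i → i = 0)
    (hctx₀ : ∀ C ∈ S.ctx X₀, C ≠ Z₀ → ∀ c i, i ≤ d.n c → ¬ (c = true ∧ i = 0) → C ∈ d.Car c i →
      C ∉ S.decisions ∧ c = true ∧ i = 1)
    (hn : 0 < d.n true) (hK : d.K true 0 = X₀)
    (hY : ∃ w ∈ d.Tr true (d.n true), (S.scopedGraph G).Adj w Y)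
    (τ : DetPolicy (S.removeContext X₀ Z₀) (d.Val N)) :
    ∃ e x, IsRun (d.mech N) (S.removeContext X₀ Z₀) τ e x ∧ (x Y .verdict : ℕ) = 1 := by
  classical
  by_contra hno
  have hKd : d.K true 0 ∈ S.decisions := by
    rw [hK]
    exact d.X₀_mem
  have hlt : ∀ (z : Fin N) (w : Fin (2 ^ N)), ∀ c i, sources z w c i < towerLevel N i :=
    fun z w => sources_lt z.2 w.2
  choose x hx using fun (z : Fin N) (w : Fin (2 ^ N)) => exists_play hA τ (hlt z w)
  have hseen : ∀ X ∈ S.decisions, ∀ C ∈ (S.removeContext X₀ Z₀).ctx X, ∀ c i, i ≤ d.n c →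
      C ∈ d.Car c i → i = 0 ∨ X = X₀ ∧ c = true ∧ i = 1 := by
    intro X hX C hC c i hi hCar
    obtain ⟨hCS, hCZ⟩ := mem_of_mem_removeContext hC
    by_cases hXX : X = X₀
    · by_cases hci : c = true ∧ i = 0
      · exact Or.inl hci.2
      · exact Or.inr ⟨hXX, (hctx₀ C (hXX ▸ hCS) (hCZ hXX) c i hi hci hCar).2⟩
    · exact Or.inl (hctx X hX hXX C hCS c i hi hCar)
  have hsource : ∀ z w, toldSource (x z w) = z := by
    intro z w
    by_contra h
    refine hno ((hx z w).exists_loss hA hYC (hlt z w) (bitsVanish_sources (Or.inr hKd))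
      (c := false) (Nat.zero_le _) d.Y_parent_false ?_ fun hex => h ?_)
    · intro X hX C hC i hi0 hi hCar
      rcases hseen X hX C hC false i hi hCar with h | h
      · omega
      · simp at h
    · rw [(hx z w).truth_eq (Nat.zero_le _) (by simp)] at hex
      exact Eq.symm hex
  have hbit : ∀ (z : Fin N) (w : Fin (2 ^ N)),
      ((w : ℕ).testBit z).toNat = toldBit (x z w) true 0 := by
    intro z w
    by_contra h
    refine hno ((hx z w).exists_loss hA hYC (hlt z w) (bitsVanish_sources (Or.inr hKd))
      (c := true) (a := 1) hn hY ?_ fun hex => h ?_)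
    · intro X hX C hC i hi1 hi hCar
      rcases hseen X hX C hC true i hi hCar with h | h
      · omega
      · omega
    · rw [(hx z w).truth_eq hn (by simp)] at hex
      obtain ⟨s, -, hs, hb⟩ := hex
      have hsz : s = z := Eq.trans hs (hsource z w)
      rw [hsz] at hb
      exact hb
  -- Among many values of the first source there are some that `X₀` cannot tell from each other.
  obtain ⟨r, hr⟩ := Fintype.exists_le_card_fiber_of_mul_le_card
    (f := fun z => shownBits (x z 0)) (n := q) (by simp [hNq])
  set T : Finset (Fin N) := Finset.univ.filter fun z => shownBits (x z 0) = r with hT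
  have hblind : ∀ z ∈ T, ∀ z' ∈ T, ∀ w, x z w X₀ = x z' w X₀ := by
    intro z hz z' hz' w
    have hloc : ∀ z, ∀ C ∈ S.ctx X₀, ∀ c i,
        nat (x z w) C (.bit c i) = nat (x z 0) C (.bit c i) := by
      intro z C hC
      refine ((hx z w).observation_eq hA hYC (hx z 0) (Q := {v | ¬ IsAnc (S.scopedGraph G) X₀ v})
        (fun v hv w hw h => hv (h.tail hw)) (bitsVanish_sources (Or.inr hKd))
        (bitsVanish_sources (Or.inr hKd)) ?_ C fun h => ?_).1
      · intro X hX hXQ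
        refine Or.inr fun C hC c i hi hci hCar => ?_
        rcases hseen X hX C hC c i hi hCar with rfl | h
        · cases c
          · rfl
          · simp at hci
        · exact absurd (h.1 ▸ Relation.ReflTransGen.refl) hXQ
      · exact hA X₀ (.tail' h (Or.inl ⟨d.X₀_mem, hC⟩))
    have hzz : shownBits (x z 0) = shownBits (x z' 0) := by
      rw [(Finset.mem_filter.mp hz).2, (Finset.mem_filter.mp hz').2]
    refine (hx z w).eq_at_decision hA hYC (hx z' w) (fun C hC _ c i => ?_) ?_
    · rw [hloc z C hC, hloc z' C hC, eq_of_shownBits_eq hzz]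
    · intro C hC hCZ c i hi hci hCar
      obtain ⟨h1, rfl, rfl⟩ := hctx₀ C hC hCZ c i hi hci hCar
      exact ⟨h1, rfl⟩
  have hq0 : 0 < q := by
    rcases Nat.eq_zero_or_pos q with rfl | h
    · exact absurd (hNq.trans (Nat.mul_zero _)) (NeZero.ne N)
    · exact h
  obtain ⟨z₀, hz₀⟩ : T.Nonempty := Finset.card_pos.mp (lt_of_lt_of_le hq0 hr)
  -- The value of `X₀` determines the bits at all these positions.
  have hw : ∀ φ : T → Bool, ∃ w : Fin (2 ^ N), ∀ z : T, (w : ℕ).testBit z.1 = φ z := by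
    intro φ
    obtain ⟨m, hm, hb⟩ := exists_testBit_eq N
      (fun s => if h : ∃ hs : s < N, (⟨s, hs⟩ : Fin N) ∈ T then φ ⟨⟨s, h.1⟩, h.2⟩ else false)
    refine ⟨⟨m, hm⟩, fun z => ?_⟩
    have h := hb z.1 z.1.2
    rw [dif_pos ⟨z.1.2, z.2⟩] at h
    exact h
  choose w hw using hw
  have hinj : Function.Injective fun φ => x z₀ (w φ) X₀ := by
    intro φ ψ h
    funext z
    have hX : x z.1 (w φ) X₀ = x z.1 (w ψ) X₀ := by
      rw [hblind z.1 z.2 z₀ hz₀, hblind z.1 z.2 z₀ hz₀]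
      exact h
    have hobs := (hx z.1 (w φ)).observation_eq hA hYC (hx z.1 (w ψ)) (Q := Set.univ)
      (fun _ _ _ _ => trivial) (bitsVanish_sources (Or.inr hKd)) (bitsVanish_sources (Or.inr hKd))
      (by
        intro X hX' _
        by_cases hXX : X = X₀
        · subst hXX
          exact Or.inl hX
        · refine Or.inr fun C hC c i hi hci hCar => ?_
          rcases hseen X hX' C hC c i hi hCar with rfl | h
          · cases c
            · rfl
            · simp at hci
          · exact absurd h.1 hXX)
    have htold := (told_eq fun v => ⟨(hobs v trivial).1, (hobs v trivial).2.1⟩).1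
    have h1 := hbit z.1 (w φ)
    rw [htold, ← hbit z.1 (w ψ), hw, hw] at h1
    revert h1
    cases φ z <;> cases ψ z <;> simp
  have hle := (Fintype.card_le_of_injective _ hinj).trans
    (card_val_le fun h => d.Y_not_mem (h ▸ d.X₀_mem))
  rw [Fintype.card_fun, Fintype.card_bool, Fintype.card_coe] at hle
  exact absurd ((Nat.pow_le_pow_right two_pos hr).trans hle) (not_le.mpr hq)

end Design

/-- The size of the game can be chosen such that `X₀` has not enough room for a string of `q`
bits. -/
theorem exists_mul_lt_two_pow (P R : ℕ) (hP : 0 < P) (hR : 0 < R) :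
    ∃ q, 2 ≤ q ∧ P * q * R < 2 ^ q := by
  refine ⟨2 * (P * R), by nlinarith [Nat.mul_pos hP hR], ?_⟩
  have h : P * R < 2 ^ (P * R) := Nat.lt_two_pow_self
  have h1 : 2 * (P * R) ≤ 2 ^ (P * R) := by
    obtain ⟨m, hm⟩ := Nat.exists_eq_succ_of_ne_zero (Nat.mul_pos hP hR).ne'
    rw [hm, pow_succ, mul_comm]
    exact Nat.mul_le_mul_right 2 Nat.lt_two_pow_self
  calc P * (2 * (P * R)) * R = (P * R) * (2 * (P * R)) := by ring
    _ ≤ (P * R) * 2 ^ (P * R) := Nat.mul_le_mul_left _ h1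
    _ < 2 ^ (P * R) * 2 ^ (P * R) := Nat.mul_lt_mul_of_pos_right h (Nat.two_pow_pos _)
    _ = 2 ^ (2 * (P * R)) := by rw [← pow_add, two_mul]

/-! ### Active paths as chains of sources -/

section SourceChain

variable {V : Type*}

/-- There is a directed path from `s` to `p` all of whose vertices, except possibly `s`, are in
`H`. -/
def Down (A : Digraph V) (H : Set V) (s p : V) : Prop :=
  Relation.ReflTransGen (fun v w => A.Adj v w ∧ w ∈ H) s p

/-- A path from `s` to `Y`, starting in the direction of an edge, that is decomposed at its forks
`U 1, ..., U n` and its colliders `K 0, ..., K (n - 1)`. All other vertices, and the forks, are in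
`H`. Vertices may be repeated. -/
structure SourceChain (A : Digraph V) (dec : Finset V) (H : Set V) (Y s : V) where
  n : ℕ
  U : ℕ → V
  K : ℕ → V
  U_zero : U 0 = s
  U_mem : ∀ i < n, U (i + 1) ∈ H
  K_not_dec : ∀ i < n, K i ∉ dec
  K_ne_Y : ∀ i < n, K i ≠ Y
  K_anc : ∀ i < n, IsAnc A (K i) Y
  left : ∀ i < n, ∃ p, Down A H (U i) p ∧ A.Adj p (K i)
  right : ∀ i < n, ∃ p, Down A H (U (i + 1)) p ∧ A.Adj p (K i)
  last : ∃ p, Down A H (U n) p ∧ A.Adj p Y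

variable {A : Digraph V} {dec : Finset V} {H : Set V} {Y s : V}

theorem Down.eq_or_mem {v : V} (h : Down A H s v) : v = s ∨ v ∈ H := by
  rcases Relation.ReflTransGen.cases_tail h with h | ⟨w, -, h⟩
  · exact Or.inl h
  · exact Or.inr h.2

theorem Down.exists_parent {v : V} (h : Down A H s v) (hne : v ≠ s) :
    ∃ w, Down A H s w ∧ A.Adj w v := by
  rcases Relation.ReflTransGen.cases_tail h with h | ⟨w, h1, h2⟩
  · exact absurd h hne
  · exact ⟨w, h1, h2.1⟩

theorem SourceChain.U_eq_or_mem (c : SourceChain A dec H Y s) {i : ℕ} (hi : i ≤ c.n) :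
    (i = 0 ∧ c.U i = s) ∨ c.U i ∈ H := by
  cases i with
  | zero => exact Or.inl ⟨rfl, c.U_zero⟩
  | succ i => exact Or.inr (c.U_mem i hi)

theorem SourceChain.nonempty_of_last {p : V} (h : Down A H s p) (h' : A.Adj p Y) :
    Nonempty (SourceChain A dec H Y s) :=
  ⟨{ n := 0, U := fun _ => s, K := fun _ => s, U_zero := rfl
     U_mem := by simp, K_not_dec := by simp, K_ne_Y := by simp, K_anc := by simp
     left := by simp, right := by simp, last := ⟨p, h, h'⟩ }⟩

theorem SourceChain.nonempty_of_link {k u p q : V} (c : SourceChain A dec H Y u) (hu : u ∈ H)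
    (hk : k ∉ dec) (hkY : k ≠ Y) (hkA : IsAnc A k Y) (hp : Down A H s p) (hpk : A.Adj p k)
    (hq : Down A H u q) (hqk : A.Adj q k) : Nonempty (SourceChain A dec H Y s) := by
  refine ⟨{ n := c.n + 1, U := fun i => i.casesOn s c.U, K := fun i => i.casesOn k c.K,
            U_zero := rfl, U_mem := ?_, K_not_dec := ?_, K_ne_Y := ?_, K_anc := ?_, left := ?_,
            right := ?_, last := c.last }⟩
  · rintro (_ | i) hi
    · exact (congrArg (· ∈ H) c.U_zero).mpr hu
    · exact c.U_mem i (Nat.lt_of_succ_lt_succ hi)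
  · rintro (_ | i) hi
    · exact hk
    · exact c.K_not_dec i (Nat.lt_of_succ_lt_succ hi)
  · rintro (_ | i) hi
    · exact hkY
    · exact c.K_ne_Y i (Nat.lt_of_succ_lt_succ hi)
  · rintro (_ | i) hi
    · exact hkA
    · exact c.K_anc i (Nat.lt_of_succ_lt_succ hi)
  · rintro (_ | i) hi
    · exact ⟨p, hp, hpk⟩
    · exact c.left i (Nat.lt_of_succ_lt_succ hi)
  · rintro (_ | i) hi
    · exact ⟨q, (congrArg (Down A H · q) c.U_zero).mpr hq, hqk⟩
    · exact c.right i (Nat.lt_of_succ_lt_succ hi)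

/-- The decomposition of an active path at its forks and colliders. The two parts of the conclusion
are for the two directions of the first edge of the path. -/
theorem exists_sourceChain_of_path (hA : IsDAG A) (l : List V) : ∀ a b : V,
    (a :: b :: l).IsChain (fun v w => A.Adj v w ∨ A.Adj w v) →
    (a :: b :: l).getLast? = some Y →
    (∀ u w v, [u, w, v] <:+: a :: b :: l → A.Adj u w → A.Adj v w →
      w ∉ dec ∧ w ≠ Y ∧ IsAnc A w Y) →
    (∀ u w v, [u, w, v] <:+: a :: b :: l → (A.Adj w u ∨ A.Adj w v) → w ∈ H) →
    (∀ s, A.Adj a b → Down A H s a → Nonempty (SourceChain A dec H Y s)) ∧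
    (A.Adj b a → IsAnc A a Y → ∃ u ∈ H, Down A H u b ∧ Nonempty (SourceChain A dec H Y u)) := by
  induction l with
  | nil =>
    intro a b _ hlast _ _
    obtain rfl : b = Y := by simpa using hlast
    exact ⟨fun s hab hs => SourceChain.nonempty_of_last hs hab,
      fun hba ha => absurd (Relation.TransGen.head' hba ha) (hA _)⟩
  | cons c l ih =>
    intro a b hch hlast hcol hnon
    have hsub : ∀ {t : List V}, t <:+: b :: c :: l → t <:+: a :: b :: c :: l := fun h =>
      h.trans (List.suffix_cons a _).isInfix
    have hpre : [a, b, c] <:+: a :: b :: c :: l :=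
      (List.prefix_append [a, b, c] l).isInfix
    obtain ⟨ihd, ihu⟩ := ih b c hch.tail (by simpa using hlast)
      (fun u w v h => hcol u w v (hsub h)) (fun u w v h => hnon u w v (hsub h))
    have hbc : A.Adj b c ∨ A.Adj c b := by
      exact (List.isChain_cons_cons.mp (List.isChain_cons_cons.mp hch).2).1
    constructor
    · intro s hab hs
      rcases hbc with hbc | hcb
      · exact ihd s hbc (hs.tail ⟨hab, hnon a b c hpre (Or.inr hbc)⟩)
      · obtain ⟨h1, h2, h3⟩ := hcol a b c hpre hab hcb
        obtain ⟨u, hu, hub, ⟨ch⟩⟩ := ihu hcb h3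
        exact ch.nonempty_of_link hu h1 h2 h3 hs hab hub hcb
    · intro hba ha
      have hb : b ∈ H := hnon a b c hpre (Or.inl hba)
      rcases hbc with hbc | hcb
      · exact ⟨b, hb, .refl, ihd b hbc .refl⟩
      · obtain ⟨u, hu, hub, hch⟩ := ihu hcb (.head hba ha)
        exact ⟨u, hu, hub.tail ⟨hcb, hb⟩, hch⟩

end SourceChain

namespace MixedPolicyScope

variable {V : Type*} {G : Digraph V} {S : MixedPolicyScope V} {Y : V}

/-- The vertices that are neither decisions nor contexts of decisions, except for `Y`. -/
def hidden (S : MixedPolicyScope V) (Y : V) : Set V :=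
  {v | v ∉ S.decisions ∧ (∀ X ∈ S.decisions, v ∉ S.ctx X) ∧ v ≠ Y}

/-- The new vertex is no descendant of an old one. -/
theorem isAnc_withPolicyNode {A : Digraph V} {X : V} {a b : Option V}
    (h : IsAnc (withPolicyNode A X) a b) : ∀ v, a = some v → ∃ w, b = some w ∧ IsAnc A v w := by
  induction h with
  | refl => exact fun v hv => ⟨v, hv, .refl⟩
  | @tail b c _ hbc ih =>
    intro v hv
    obtain ⟨w, rfl, hw⟩ := ih v hv
    match c, hbc with
    | some c, hbc => exact ⟨c, rfl, hw.tail hbc⟩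

theorem exists_eq_map_some {α : Type*} : ∀ l : List (Option α), none ∉ l →
    ∃ q : List α, l = q.map some
  | [], _ => ⟨[], rfl⟩
  | none :: l, h => absurd List.mem_cons_self h
  | some a :: l, h => by
    obtain ⟨q, rfl⟩ := exists_eq_map_some l fun h' => h (List.mem_cons_of_mem _ h')
    exact ⟨a :: q, rfl⟩

/-- In a list without repetitions, only the first vertex of a triple can be the head. -/
theorem infix_cons_ne {α : Type*} {a u w v : α} {l : List α} (hl : (a :: l).Nodup)
    (h : [u, w, v] <:+: a :: l) : w ≠ a ∧ v ≠ a := by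
  obtain ⟨s, t, h⟩ := h
  rw [← h] at hl
  match s, h with
  | [], h =>
    simp only [List.nil_append, List.cons_append, List.cons.injEq] at h
    obtain ⟨rfl, -⟩ := h
    simp at hl
    exact ⟨fun h => hl.1.1 h.symm, fun h => hl.1.2.1 h.symm⟩
  | b :: s, h =>
    simp only [List.cons_append, List.cons.injEq] at h
    obtain ⟨rfl, -⟩ := h
    simp at hl
    exact ⟨fun h => hl.1.2.2.1 h.symm, fun h => hl.1.2.2.2.1 h.symm⟩

/-- In a list without repetitions, only the third vertex of a triple can be the last one, and it has
a successor otherwise. -/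
theorem infix_getLast {α : Type*} {b u w v : α} {l : List α} (hl : l.Nodup)
    (hb : l.getLast? = some b) (h : [u, w, v] <:+: l) :
    w ≠ b ∧ (v ≠ b → ∃ t, [w, v, t] <:+: l) := by
  obtain ⟨s, t, h⟩ := h
  match t, h with
  | [], h =>
    rw [← h] at hb hl
    obtain rfl : v = b := by simpa using hb
    rw [List.append_nil, List.nodup_append] at hl
    refine ⟨fun h => ?_, fun h => absurd rfl h⟩
    have := hl.2.1
    simp [h] at this
  | x :: t, h =>
    refine ⟨?_, fun _ => ⟨x, s ++ [u], t, by simpa using h⟩⟩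
    rintro rfl
    rw [← h] at hb hl
    have h1 : w ∈ v :: x :: t := by
      have h2 : (v :: x :: t).getLast? = some w := by
        simpa using hb
      exact List.mem_of_getLast? h2
    rw [List.append_assoc, List.nodup_append] at hl
    have := hl.2.1
    rw [List.cons_append, List.cons_append, List.cons_append, List.nil_append, List.nodup_cons,
      List.nodup_cons] at this
    exact this.2.1 h1

/-- What the condition on the policy node gives for a context `Z` of `X`. If `Z` is a decision, it
is not implied, hence it has a context that is private to it and not a decision. Otherwise there is
an active path from `Z` to `Y`, along which non-colliders are hidden. It starts either with an edge
out of `Z`, or with a directed path into `Z`. -/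
theorem exists_sourceChain (hA : IsDAG (S.scopedGraph G)) (hYD : Y ∉ S.decisions)
    (hYC : ∀ X ∈ S.decisions, Y ∉ S.ctx X) (hanc : ∀ X ∈ S.decisions, IsAnc (S.scopedGraph G) X Y)
    {X Z : V} (hX : X ∈ S.decisions) (hZ : Z ∈ S.ctx X)
    (hC : DConnected (withPolicyNode (S.scopedGraph G) X) {none} {some Y}
        (some '' S.implied
          (((S.decisions : Set V) ∪ S.ctxOf ((S.decisions : Set V) \ {Z})) \ {Z}))) :
    (Z ∈ S.decisions → ∃ C ∈ S.ctx Z, C ∉ S.decisions ∧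
      ∀ X' ∈ S.decisions, C ∈ S.ctx X' → X' = Z) ∧
    (Z ∉ S.decisions → ∃ s, Nonempty
      (SourceChain (S.scopedGraph G) S.decisions (S.hidden Y) Y s) ∧
      (s = Z ∨ s ∈ S.hidden Y ∧
        ∃ p, Down (S.scopedGraph G) (S.hidden Y) s p ∧ (S.scopedGraph G).Adj p Z)) := by
  set A := S.scopedGraph G with hAdef
  set W := S.implied (((S.decisions : Set V) ∪ S.ctxOf ((S.decisions : Set V) \ {Z})) \ {Z})
    with hW
  have hctx : ∀ {C D : V}, D ∈ S.decisions → C ∈ S.ctx D → A.Adj C D := fun hD hC =>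
    Or.inl ⟨hD, hC⟩
  have hctx' : ∀ {C D : V}, D ∈ S.decisions → A.Adj C D → C ∈ S.ctx D := by
    rintro C D hD (⟨-, h⟩ | ⟨h, -⟩)
    · exact h
    · exact absurd hD h
  have hirr : ∀ v, ¬ A.Adj v v := fun v h => hA v (.single h)
  have hXZ : X ≠ Z := fun h => hirr X (hctx hX (by rw [h] at hZ ⊢; exact hZ))
  have hdecW : ∀ D ∈ S.decisions, D ≠ Z → D ∈ W := fun D hD hne =>
    Implied.base ⟨Or.inl hD, hne⟩
  have hctxW : ∀ D ∈ S.decisions, D ≠ Z → ∀ C ∈ S.ctx D, C ≠ Z → C ∈ W :=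
    fun D hD hne C hC hCne => Implied.base ⟨Or.inr ⟨D, ⟨hD, hne⟩, hC⟩, hCne⟩
  unfold DConnected DSeparated at hC
  push Not at hC
  obtain ⟨_, rfl, _, rfl, p, hp, hnb⟩ := hC
  obtain ⟨hnd, hch, hhead, hlast⟩ := hp
  unfold PathBlocked at hnb
  push Not at hnb
  obtain ⟨hcol, hnon, -⟩ := hnb
  -- The path has the form `π_X, X, Z, b, ...`.
  obtain ⟨p, rfl⟩ : ∃ p', p = none :: p' := by
    cases p with
    | nil => simp at hhead
    | cons a p => exact ⟨p, by simpa using hhead⟩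
  obtain ⟨q, rfl⟩ := exists_eq_map_some p (List.nodup_cons.mp hnd).1
  have hqnd : q.Nodup := (List.nodup_cons.mp hnd).2.of_map some
  match q, hqnd, hch, hlast, hcol, hnon with
  | [], _, _, hlast, _, _ => simp at hlast
  | [x], _, hch, hlast, _, _ =>
    obtain rfl : x = X := by simpa [withPolicyNode] using hch
    obtain rfl : x = Y := by simpa using hlast
    exact absurd hX hYD
  | x :: z :: r, hqnd, hch, hlast, hcol, hnon =>
    rw [List.map_cons, List.isChain_cons_cons] at hch
    obtain ⟨hx, hch⟩ := hch
    obtain rfl : x = X := by simpa [withPolicyNode] using hx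
    have hch : (x :: z :: r).IsChain (fun v w => A.Adj v w ∨ A.Adj w v) := by
      have : ((x :: z :: r).map some).IsChain (fun v w => (withPolicyNode A x).Adj v w ∨
        (withPolicyNode A x).Adj w v) := hch
      rw [List.isChain_map] at this
      exact this
    have hlast : (x :: z :: r).getLast? = some Y := by
      rw [List.map_cons, List.getLast?_cons_cons] at hlast
      rw [← List.map_cons, List.getLast?_map] at hlast
      simpa using hlast
    have hsub : ∀ {u w v : V}, [u, w, v] <:+: x :: z :: r →
        [some u, some w, some v] <:+: none :: (x :: z :: r).map some := fun h =>
      (h.map some).trans (List.suffix_cons none _).isInfix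
    have hnon' : ∀ u w v, [u, w, v] <:+: x :: z :: r → (A.Adj w u ∨ A.Adj w v) → w ∉ W :=
      fun u w v h hadj hw => hnon _ _ _ (hsub h) hadj ⟨w, hw, rfl⟩
    have hcol' : ∀ u w v, [u, w, v] <:+: x :: z :: r → A.Adj u w → A.Adj v w →
        ∃ y ∈ W, IsAnc A w y := by
      intro u w v h h1 h2
      obtain ⟨y, hy, y', hy', rfl⟩ := hcol _ _ _ (hsub h) ⟨h1, h2⟩
      obtain ⟨y'', h3, h4⟩ := isAnc_withPolicyNode hy w rfl
      obtain rfl := Option.some.inj h3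
      exact ⟨_, hy', h4⟩
    have hzx : A.Adj z x := by
      rw [List.isChain_cons_cons] at hch
      refine hch.1.resolve_left fun h => ?_
      exact hnon none (some x) (some z) (List.prefix_append _ (r.map some)).isInfix (Or.inr h)
        ⟨x, hdecW x hX hXZ, rfl⟩
    match r, hqnd, hch, hlast, hnon', hcol' with
    | [], _, _, hlast, _, _ =>
      obtain rfl : z = Y := by simpa using hlast
      exact absurd (hctx' hX hzx) (hYC x hX)
    | b :: r, hqnd, hch, hlast, hnon', hcol' =>
      have hzW : z ∉ W := hnon' x z b (List.prefix_append [x, z, b] r).isInfix (Or.inl hzx)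
      obtain rfl : z = Z := by
        by_contra hne
        exact hzW (hctxW x hX hXZ z (hctx' hX hzx) hne)
      constructor
      · intro hzd
        by_contra! hno
        refine hzW (Implied.step hzd fun C hC => ?_)
        have hCz : C ≠ z := fun h => hirr z (hctx hzd (by rw [h] at hC; exact hC))
        by_cases hCd : C ∈ S.decisions
        · exact hdecW C hCd hCz
        · obtain ⟨D, hD, hCD, hne⟩ := hno C hC hCd
          exact hctxW D hD hne C hCD hCz
      · intro hzd
        have hnd' : (z :: b :: r).Nodup := (List.nodup_cons.mp hqnd).2
        have hlast' : (z :: b :: r).getLast? = some Y := by simpa using hlast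
        have hsub' : ∀ {t : List V}, t <:+: z :: b :: r → t <:+: x :: z :: b :: r := fun h =>
          h.trans (List.suffix_cons x _).isInfix
        have hne : ∀ {D : V}, D ∈ S.decisions → D ≠ z := fun hD h => hzd (h ▸ hD)
        have hWanc : ∀ y ∈ W, IsAnc A y Y := by
          intro y hy
          cases hy with
          | base h =>
            rcases h.1 with h | ⟨D, hD, h⟩
            · exact hanc y h
            · exact .head (hctx hD.1 h) (hanc D hD.1)
          | step h _ => exact hanc y h
        have hcol'' : ∀ u w v, [u, w, v] <:+: z :: b :: r → A.Adj u w → A.Adj v w →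
            w ∉ S.decisions ∧ w ≠ Y ∧ IsAnc A w Y := by
          intro u w v h huw hvw
          obtain ⟨y, hy, hwy⟩ := hcol' u w v (hsub' h) huw hvw
          obtain ⟨hwY, hnext⟩ := infix_getLast hnd' hlast' h
          refine ⟨fun hwd => ?_, hwY, hwy.trans (hWanc y hy)⟩
          -- A decision on the path is a collider, but then the next vertex is an observed
          -- non-collider.
          have hvc := hctx' hwd hvw
          have hvY : v ≠ Y := fun h => hYC w hwd (h ▸ hvc)
          obtain ⟨t, ht⟩ := hnext hvY
          exact hnon' w v t (hsub' ht) (Or.inl hvw)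
            (hctxW w hwd (hne hwd) v hvc (infix_cons_ne hnd' h).2)
        have hnon'' : ∀ u w v, [u, w, v] <:+: z :: b :: r → (A.Adj w u ∨ A.Adj w v) →
            w ∈ S.hidden Y := by
          intro u w v h hadj
          have hwW := hnon' u w v (hsub' h) hadj
          have hwz := (infix_cons_ne hnd' h).1
          exact ⟨fun hwd => hwW (hdecW w hwd hwz),
            fun D hD hwD => hwW (hctxW D hD (hne hD) w hwD hwz), (infix_getLast hnd' hlast' h).1⟩
        obtain ⟨hd, hu⟩ := exists_sourceChain_of_path (dec := S.decisions) (H := S.hidden Y) hA r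
          z b hch.tail hlast' hcol'' hnon''
        rcases (List.isChain_cons_cons.mp hch.tail).1 with h | h
        · exact ⟨z, hd z h .refl, Or.inl rfl⟩
        · obtain ⟨u, huH, hub, hc⟩ := hu h (.head hzx (hanc x hX))
          exact ⟨u, hc, Or.inr ⟨huH, b, hub, h⟩⟩

end MixedPolicyScope

/-! ### Games from paths -/

/-- There is a directed path from `s` to `v` on which no vertex, except possibly `s`, is a
decision. -/
abbrev DecisionFree {V : Type*} (A : Digraph V) (dec : Finset V) (s v : V) : Prop :=
  Down A {v | v ∉ dec} s v

/-- The graphical data from which a game is built: a chain of sources `c₀` whose first source `s₀`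
is known to a vertex `B`, which is `Z₀` or a private context of the decision `Z₀`, and, if `on` is
true, a second chain `c₁`. The bit of its first source `s₁` is emitted either by a collider `k` that
the claim of `X₀` reaches without the help of decisions, or by `X₀` itself, which then learns the
value of `s₁` from a context in the set `E`. -/
structure GamePlan {V : Type*} (S : MixedPolicyScope V) (A : Digraph V) (X₀ Z₀ Y : V) where
  s₀ : V
  c₀ : SourceChain A S.decisions (S.hidden Y) Y s₀
  B : V
  s₀_eq : s₀ = B ∨ s₀ ∈ S.hidden Y ∧ ∃ p, Down A (S.hidden Y) s₀ p ∧ A.Adj p B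
  B_not_dec : B ∉ S.decisions
  B_ne_Y : B ≠ Y
  Z₀_eq : Z₀ = B ∨ Z₀ ∈ S.decisions ∧ A.Adj B Z₀ ∧ ∀ X ∈ S.decisions, B ∈ S.ctx X → X = Z₀
  on : Bool
  s₁ : V
  c₁ : SourceChain A S.decisions (S.hidden Y) Y s₁
  E : Set V
  s₁_mem : on = true → s₁ ∈ S.hidden Y ∨ s₁ ∈ E
  E_spec : ∀ v ∈ E, v ∉ S.decisions ∧ v ≠ Y ∧
    (v = s₁ ∨ ∃ p, Down A (S.hidden Y) s₁ p ∧ A.Adj p v)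
  k : V
  k_spec : on = true → (k ∉ S.decisions ∧ k ≠ Y ∧ IsAnc A k Y ∧
    (∃ p, DecisionFree A S.decisions X₀ p ∧ A.Adj p k) ∧
    ∃ p, Down A (S.hidden Y) s₁ p ∧ A.Adj p k) ∨ (k = X₀ ∧ ∃ C ∈ E, A.Adj C X₀)

namespace GamePlan

variable {V : Type*} {S : MixedPolicyScope V} {A : Digraph V} {X₀ Z₀ Y : V}
  (P : GamePlan S A X₀ Z₀ Y)

/-- The heights of the last sources of the two chains. -/
def n : Bool → ℕ
  | false => P.c₀.n
  | true => if P.on then P.c₁.n + 1 else 0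

/-- The sources. -/
def U : Bool → ℕ → V
  | false, i => P.c₀.U i
  | true, 0 => X₀
  | true, i + 1 => P.c₁.U i

/-- The vertices where bits are emitted. -/
def K : Bool → ℕ → V
  | false, i => P.c₀.K i
  | true, 0 => P.k
  | true, i + 1 => P.c₁.K i

/-- The vertices to which the value of a source is passed on without the help of decisions. -/
def Tr : Bool → ℕ → Set V
  | false, i => {v | i ≤ P.c₀.n ∧ (Down A (S.hidden Y) (P.c₀.U i) v ∨ i = 0 ∧ v = P.B)}
  | true, 0 => {v | DecisionFree A S.decisions X₀ v ∧ v ≠ Y ∧ IsAnc A v Y}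
  | true, i + 1 => {v | P.on = true ∧ i ≤ P.c₁.n ∧
      (Down A (S.hidden Y) (P.c₁.U i) v ∨ i = 0 ∧ v ∈ P.E)}

/-- The vertices to which the value of a source is passed on. -/
def Car : Bool → ℕ → Set V
  | false, i => P.Tr false i ∪ {v | i = 0 ∧ v = Z₀}
  | true, 0 => {v | IsAnc A X₀ v ∧ v ≠ Y ∧ IsAnc A v Y}
  | true, i + 1 => P.Tr true (i + 1)

variable {P}

theorem U_succ_le {i : ℕ} (hi : i + 1 ≤ P.n true) : P.on = true ∧ i ≤ P.c₁.n := by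
  unfold n at hi
  cases h : P.on
  · simp [h] at hi
  · simp only [h, if_true] at hi
    exact ⟨rfl, by omega⟩

theorem not_dec_of_mem_Tr_false {i : ℕ} {v : V} (hv : v ∈ P.Tr false i) : v ∉ S.decisions ∧
    v ≠ Y := by
  obtain ⟨hi, hv | ⟨-, rfl⟩⟩ := hv
  · rcases hv.eq_or_mem with rfl | h
    · rcases P.c₀.U_eq_or_mem hi with ⟨-, h⟩ | h
      · rw [h]
        rcases P.s₀_eq with h | h
        · rw [h]
          exact ⟨P.B_not_dec, P.B_ne_Y⟩
        · exact ⟨h.1.1, h.1.2.2⟩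
      · exact ⟨h.1, h.2.2⟩
    · exact ⟨h.1, h.2.2⟩
  · exact ⟨P.B_not_dec, P.B_ne_Y⟩

theorem mem_hidden_or_of_mem_Tr_true {i : ℕ} {v : V} (hv : v ∈ P.Tr true (i + 1)) :
    v ∈ S.hidden Y ∨ i = 0 ∧ v ∈ P.E := by
  obtain ⟨hon, hi, hv | hv⟩ := hv
  · rcases hv.eq_or_mem with rfl | h
    · rcases P.c₁.U_eq_or_mem hi with ⟨rfl, h⟩ | h
      · rw [h]
        exact (P.s₁_mem hon).imp_right fun h => ⟨rfl, h⟩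
      · exact Or.inl h
    · exact Or.inl h
  · exact Or.inr hv

theorem not_dec_of_mem_Tr_true {i : ℕ} {v : V} (hv : v ∈ P.Tr true (i + 1)) :
    v ∉ S.decisions ∧ v ≠ Y := by
  rcases mem_hidden_or_of_mem_Tr_true hv with h | h
  · exact ⟨h.1, h.2.2⟩
  · exact ⟨(P.E_spec v h.2).1, (P.E_spec v h.2).2.1⟩

/-- Only the values of the first sources are known to contexts, apart from those in `E`. -/
theorem eq_zero_of_mem_ctx {X C : V} (hX : X ∈ S.decisions) (hC : C ∈ S.ctx X) {c : Bool} {i : ℕ}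
    (hCar : C ∈ P.Car c i) : i = 0 ∨ c = true ∧ i = 1 ∧ C ∈ P.E := by
  match c, i, hCar with
  | false, 0, _ => exact Or.inl rfl
  | true, 0, _ => exact Or.inl rfl
  | false, i + 1, hCar =>
    exfalso
    rcases hCar with ⟨hi, hv | ⟨h, -⟩⟩ | ⟨h, -⟩
    · rcases hv.eq_or_mem with h | h
      · exact (P.c₀.U_mem i hi).2.1 X hX (h ▸ hC)
      · exact h.2.1 X hX hC
    · simp at h
    · simp at h
  | true, i + 1, hCar =>
    rcases mem_hidden_or_of_mem_Tr_true hCar with h | ⟨rfl, h⟩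
    · exact absurd hC (h.2.1 X hX)
    · exact Or.inr ⟨rfl, rfl, h⟩

/-- A context other than `Z₀` that knows the value of the first source is a context of the decision
`Z₀` only. -/
theorem eq_of_mem_ctx_of_mem_Car {X C : V} (hX : X ∈ S.decisions) (hC : C ∈ S.ctx X)
    (hCZ : C ≠ Z₀) (hCar : C ∈ P.Car false 0) : X = Z₀ := by
  have hCB : C = P.B := by
    rcases hCar with ⟨-, hv | ⟨-, h⟩⟩ | ⟨-, h⟩
    · rcases hv.eq_or_mem with h | h
      · rw [P.c₀.U_zero] at h
        rcases P.s₀_eq with h' | h'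
        · exact h.trans h'
        · exact absurd hC (h ▸ h'.1.2.1 X hX)
      · exact absurd hC (h.2.1 X hX)
    · exact h
    · exact absurd h hCZ
  subst hCB
  rcases P.Z₀_eq with h | ⟨-, -, h⟩
  · exact absurd h.symm hCZ
  · exact h X hX hC

variable (P)

theorem exists_parent_Tr (hA : IsDAG A) : ∀ c i v, v ∈ P.Tr c i → v ≠ P.U c i →
    ∃ w ∈ P.Tr c i, A.Adj w v := by
  rintro (_ | _) i v hv hU
  · obtain ⟨hi, hv | ⟨rfl, rfl⟩⟩ := hv
    · obtain ⟨w, hw, hwv⟩ := hv.exists_parent hU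
      exact ⟨w, ⟨hi, Or.inl hw⟩, hwv⟩
    · rcases P.s₀_eq with h | ⟨-, p, hp, hpB⟩
      · exact absurd (h.symm.trans P.c₀.U_zero.symm) hU
      · exact ⟨p, ⟨hi, Or.inl (by rw [P.c₀.U_zero]; exact hp)⟩, hpB⟩
  · match i, hv, hU with
    | 0, hv, hU =>
      obtain ⟨w, hw, hwv⟩ := hv.1.exists_parent hU
      exact ⟨w, ⟨hw, fun h => hA Y (.head' (h.symm ▸ hwv) hv.2.2), .head hwv hv.2.2⟩, hwv⟩
    | i + 1, hv, hU =>
      obtain ⟨hon, hi, hv | ⟨rfl, hv⟩⟩ := hv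
      · obtain ⟨w, hw, hwv⟩ := hv.exists_parent hU
        exact ⟨w, ⟨hon, hi, Or.inl hw⟩, hwv⟩
      · rcases (P.E_spec v hv).2.2 with h | ⟨p, hp, hpv⟩
        · exact absurd (h.trans P.c₁.U_zero.symm) hU
        · exact ⟨p, ⟨hon, hi, Or.inl (by rw [P.c₁.U_zero]; exact hp)⟩, hpv⟩

theorem exists_parent_Tr_of_on (hon : P.on = true) :
    ∃ w ∈ P.Tr true (P.n true), A.Adj w Y := by
  obtain ⟨p, hp, hpY⟩ := P.c₁.last
  refine ⟨p, ?_, hpY⟩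
  simp only [n, hon, if_true]
  exact ⟨hon, le_rfl, Or.inl hp⟩

theorem exists_parent_Car_zero (hA : IsDAG A) (hX : X₀ ∈ S.decisions) (hYD : Y ∉ S.decisions)
    (hXY : IsAnc A X₀ Y) : ∃ w ∈ P.Car true 0, A.Adj w Y := by
  rcases Relation.ReflTransGen.cases_tail hXY with h | ⟨w, hw, hwY⟩
  · exact absurd (h ▸ hX) hYD
  · exact ⟨w, ⟨hw, fun h => hA Y (.single (by rwa [h] at hwY)), .single hwY⟩, hwY⟩

/-- The game that is built from the graphical data. -/
def design (hA : IsDAG A) (hX : X₀ ∈ S.decisions) (hYD : Y ∉ S.decisions) (hXY : IsAnc A X₀ Y)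
    (hZ : A.Adj Z₀ X₀) (hZY : Z₀ ≠ Y) : Design A S.decisions X₀ Z₀ Y where
  n := P.n
  U := P.U
  K := P.K
  Tr := P.Tr
  Car := P.Car
  U_true_zero := rfl
  U_mem := by
    rintro (_ | _) i hi
    · exact ⟨hi, Or.inl .refl⟩
    · match i, hi with
      | 0, _ => exact ⟨.refl, fun h => hYD (h ▸ hX), hXY⟩
      | i + 1, hi => exact ⟨(U_succ_le hi).1, (U_succ_le hi).2, Or.inl .refl⟩
  U_not_dec := by
    rintro (_ | _) i hi hd
    · exact absurd hd (not_dec_of_mem_Tr_false (P := P) ⟨hi, Or.inl .refl⟩).1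
    · match i, hi, hd with
      | 0, _, _ => exact ⟨rfl, rfl⟩
      | i + 1, hi, hd =>
        exact absurd hd (not_dec_of_mem_Tr_true (P := P)
          ⟨(U_succ_le hi).1, (U_succ_le hi).2, Or.inl .refl⟩).1
  Tr_sub := by
    rintro (_ | _) i v hv
    · exact Or.inl hv
    · match i, hv with
      | 0, hv => exact ⟨Relation.ReflTransGen.mono (fun _ _ h => h.1) _ _ hv.1, hv.2⟩
      | i + 1, hv => exact hv
  Tr_not_dec := by
    rintro (_ | _) i v hv hU
    · exact (not_dec_of_mem_Tr_false hv).1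
    · match i, hv, hU with
      | 0, hv, hU => exact hv.1.eq_or_mem.resolve_left hU
      | i + 1, hv, _ => exact (not_dec_of_mem_Tr_true hv).1
  Tr_parent := P.exists_parent_Tr hA
  Car_ne_Y := by
    rintro (_ | _) i hY
    · rcases hY with hY | ⟨-, h⟩
      · exact (not_dec_of_mem_Tr_false hY).2 rfl
      · exact hZY h.symm
    · match i, hY with
      | 0, hY => exact hY.2.1 rfl
      | i + 1, hY => exact (not_dec_of_mem_Tr_true hY).2 rfl
  Car_parent := by
    rintro (_ | _) i v hv hU
    · have hTr : ∀ v, v ∈ P.Tr false i → v ≠ P.U false i → ∃ w ∈ P.Car false i, A.Adj w v := by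
        intro v hv hU
        obtain ⟨w, hw, hwv⟩ := P.exists_parent_Tr hA false i v hv hU
        exact ⟨w, Or.inl hw, hwv⟩
      rcases hv with hv | ⟨rfl, rfl⟩
      · exact hTr v hv hU
      · have hB : P.B ∈ P.Tr false 0 := ⟨Nat.zero_le _, Or.inr ⟨rfl, rfl⟩⟩
        rcases P.Z₀_eq with h | h
        · exact hTr v ⟨Nat.zero_le _, Or.inr ⟨rfl, h⟩⟩ hU
        · exact ⟨P.B, Or.inl hB, h.2.1⟩
    · match i, hv, hU with
      | 0, hv, hU =>
        rcases Relation.ReflTransGen.cases_tail hv.1 with h | ⟨w, hw, hwv⟩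
        · exact absurd h hU
        · exact ⟨w, ⟨hw, fun h => hA Y (.head' (h ▸ hwv) hv.2.2), .head hwv hv.2.2⟩, hwv⟩
      | i + 1, hv, hU => exact P.exists_parent_Tr hA true (i + 1) v hv hU
  Car_nondec := by
    rintro (_ | _) i v hv hd
    · rcases hv with hv | ⟨rfl, rfl⟩
      · exact Or.inr hv
      · rcases P.Z₀_eq with h | h
        · exact Or.inr ⟨Nat.zero_le _, Or.inr ⟨rfl, h⟩⟩
        · exact absurd h.1 hd
    · match i, hv with
      | 0, _ => exact Or.inl ⟨rfl, rfl⟩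
      | i + 1, hv => exact Or.inr hv
  K_anc := by
    rintro (_ | _) i hi
    · exact P.c₀.K_anc i hi
    · match i, hi with
      | 0, hi =>
        rcases P.k_spec (U_succ_le hi).1 with h | h
        · exact h.2.2.1
        · exact (congrArg (IsAnc A · Y) h.1).mpr hXY
      | i + 1, hi => exact P.c₁.K_anc i (U_succ_le hi).2
  K_ne_Y := by
    rintro (_ | _) i hi
    · exact P.c₀.K_ne_Y i hi
    · match i, hi with
      | 0, hi =>
        rcases P.k_spec (U_succ_le hi).1 with h | h
        · exact h.2.1
        · exact fun h' => hYD (h'.symm.trans h.1 ▸ hX)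
      | i + 1, hi => exact P.c₁.K_ne_Y i (U_succ_le hi).2
  K_parent := by
    rintro (_ | _) i hi hd
    · obtain ⟨p, hp, hpk⟩ := P.c₀.left i hi
      obtain ⟨q, hq, hqk⟩ := P.c₀.right i hi
      exact ⟨⟨p, ⟨Nat.le_of_lt hi, Or.inl hp⟩, hpk⟩, ⟨q, ⟨hi, Or.inl hq⟩, hqk⟩⟩
    · match i, hi, hd with
      | 0, hi, hd =>
        have hon := (U_succ_le hi).1
        rcases P.k_spec hon with ⟨-, -, hkY, ⟨p, hp, hpk⟩, ⟨q, hq, hqk⟩⟩ | ⟨h, -⟩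
        · refine ⟨⟨p, ⟨hp, fun h => hA Y (.head' (h ▸ hpk) hkY), .head hpk hkY⟩, hpk⟩, ⟨q, ?_, hqk⟩⟩
          exact ⟨hon, Nat.zero_le _, Or.inl (by rw [P.c₁.U_zero]; exact hq)⟩
        · exact absurd ((congrArg (· ∈ S.decisions) h).mpr hX) hd
      | i + 1, hi, _ =>
        obtain ⟨hon, hi⟩ := U_succ_le hi
        obtain ⟨p, hp, hpk⟩ := P.c₁.left i hi
        obtain ⟨q, hq, hqk⟩ := P.c₁.right i hi
        exact ⟨⟨p, ⟨hon, Nat.le_of_lt hi, Or.inl hp⟩, hpk⟩, ⟨q, ⟨hon, hi, Or.inl hq⟩, hqk⟩⟩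
  K_dec := by
    rintro (_ | _) i hi hd
    · exact absurd hd (P.c₀.K_not_dec i hi)
    · match i, hi, hd with
      | 0, hi, hd =>
        have hon := (U_succ_le hi).1
        rcases P.k_spec hon with h | ⟨h, C, hC, hCX⟩
        · exact absurd hd h.1
        · exact ⟨h, rfl, rfl, C, ⟨hon, Nat.zero_le _, Or.inr ⟨rfl, hC⟩⟩, hCX⟩
      | i + 1, hi, hd => exact absurd hd (P.c₁.K_not_dec i (U_succ_le hi).2)
  Y_parent_false := by
    obtain ⟨p, hp, hpY⟩ := P.c₀.last
    exact ⟨p, ⟨le_rfl, Or.inl hp⟩, hpY⟩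
  Y_parent := by
    rintro (_ | _)
    · obtain ⟨p, hp, hpY⟩ := P.c₀.last
      exact ⟨p, Or.inl ⟨le_rfl, Or.inl hp⟩, hpY⟩
    · cases hon : P.on
      · have hn : P.n true = 0 := by simp [n, hon]
        rw [hn]
        exact P.exists_parent_Car_zero hA hX hYD hXY
      · have hn : P.n true = P.c₁.n + 1 := by simp [n, hon]
        have h := P.exists_parent_Tr_of_on hon
        rw [hn] at h ⊢
        exact h
  Y_parent_zero := P.exists_parent_Car_zero hA hX hYD hXY
  X₀_mem := hX
  Y_not_mem := hYD
  Z₀_adj := hZ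
  Z₀_mem := Or.inr ⟨rfl, rfl⟩
  X₀_Car := by
    rintro (_ | _) i hi
    · rcases hi with h | ⟨-, h⟩
      · exact absurd hX (not_dec_of_mem_Tr_false h).1
      · exact absurd (.single (h ▸ hZ)) (hA X₀)
    · match i, hi with
      | 0, _ => exact ⟨rfl, rfl⟩
      | i + 1, hi => exact absurd hX (not_dec_of_mem_Tr_true hi).1
  Car_zero := fun v hv => hv.1

end GamePlan

/-! ### The construction of the game -/

namespace GamePlan

variable {V : Type*} [Fintype V] {G : Digraph V} {S : MixedPolicyScope V} {X₀ Z₀ Y : V}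

/-- The context `Z₀` is material in the game that is built from graphical data, in each of the three
cases in which there is a loss for every policy that does not use it. -/
theorem exists_material (P : GamePlan S (S.scopedGraph G) X₀ Z₀ Y) (hG : IsDAG G)
    (hA : IsDAG (S.scopedGraph G)) (hYD : Y ∉ S.decisions) (hYC : ∀ X ∈ S.decisions, Y ∉ S.ctx X)
    (hX : X₀ ∈ S.decisions) (hXY : IsAnc (S.scopedGraph G) X₀ Y) (hZ : Z₀ ∈ S.ctx X₀)
    (hP : (P.E = ∅ ∧ ∃ w ∈ P.Tr true (P.n true), (S.scopedGraph G).Adj w Y) ∨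
      (P.E = ∅ ∧ Z₀ ∉ S.decisions ∧ ∀ X ∈ S.decisions, Z₀ ∈ S.ctx X → X = X₀) ∨
      (P.on = true ∧ P.k = X₀ ∧ ∀ C ∈ P.E, ∀ X ∈ S.decisions, C ∈ S.ctx X → X = X₀)) :
    ∃ M : SCM V Y, M.CompatibleWith G ∧ M.Material S X₀ Z₀ := by
  have hadj : (S.scopedGraph G).Adj Z₀ X₀ := Or.inl ⟨hX, hZ⟩
  have hne : X₀ ≠ Z₀ := fun h => hA X₀ (.single (h ▸ hadj))
  have hZY : Z₀ ≠ Y := fun h => hYC X₀ hX (h ▸ hZ)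
  let d := P.design hA hX hYD hXY hadj hZY
  obtain ⟨q, hq2, hq⟩ := exists_mul_lt_two_pow
    ((2 ^ Fintype.card (Register d.n)) ^ Fintype.card V) (2 ^ Fintype.card (Register d.n))
    (by positivity) (by positivity)
  have hpos : 0 < (2 ^ Fintype.card (Register d.n)) ^ Fintype.card V := by positivity
  obtain ⟨N, hN⟩ : ∃ N, N = (2 ^ Fintype.card (Register d.n)) ^ Fintype.card V * q := ⟨_, rfl⟩
  rw [← hN] at hq
  have hN2 : 2 ≤ N := by nlinarith
  have hNlt : (2 ^ Fintype.card (Register d.n)) ^ Fintype.card V < N := by nlinarith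
  have : NeZero N := ⟨by omega⟩
  refine Design.exists_material (d := d) (N := N) hG hA fun τ => ?_
  rcases hP with ⟨hE, hYp⟩ | ⟨hE, hZd, huniq⟩ | ⟨hon, hk, hE⟩
  · refine Design.exists_loss_of_direct (d := d) hA hYC hNlt ?_ ?_ hYp τ
    · intro X hX C hC c i _ hCar
      refine (eq_zero_of_mem_ctx hX hC hCar).resolve_right fun h => ?_
      rw [hE] at h
      exact h.2.2
    · exact fun C hC hCZ hCar => hne (eq_of_mem_ctx_of_mem_Car hX hC hCZ hCar)
  · refine Design.exists_loss_of_unseen (d := d) hA hYC hN2 ?_ τ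
    intro X hX' C hC c i _ hci hCar
    obtain ⟨hCS, hCZ⟩ := Design.mem_of_mem_removeContext hC
    rcases eq_zero_of_mem_ctx hX' hCS hCar with rfl | ⟨-, -, h⟩
    · cases c
      · have hCZ : C ≠ Z₀ := fun h => hCZ (huniq X hX' (h ▸ hCS)) h
        exact hZd (eq_of_mem_ctx_of_mem_Car hX' hCS hCZ hCar ▸ hX')
      · exact hci ⟨rfl, rfl⟩
    · rw [hE] at h
      exact h
  · refine Design.exists_loss_of_private (d := d) hA hYC hN hq ?_ ?_ ?_ hk (P.exists_parent_Tr_of_on hon) τ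
    · intro X hX' hXX C hC c i _ hCar
      exact (eq_zero_of_mem_ctx hX' hC hCar).resolve_right fun h => hXX (hE C h.2.2 X hX' hC)
    · intro C hC hCZ c i _ hci hCar
      rcases eq_zero_of_mem_ctx hX hC hCar with rfl | ⟨h1, h2, h3⟩
      · cases c
        · exact absurd (eq_of_mem_ctx_of_mem_Car hX hC hCZ hCar) hne
        · exact absurd ⟨rfl, rfl⟩ hci
      · exact ⟨(P.E_spec C h3).1, h1, h2⟩
    · change 0 < P.n true
      simp [n, hon]

end GamePlan

/-- The chain of sources that remains if the first source is dropped. -/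
def SourceChain.tail {V : Type*} {A : Digraph V} {dec : Finset V} {H : Set V} {Y s : V}
    (c : SourceChain A dec H Y s) (hn : 0 < c.n) : SourceChain A dec H Y (c.U 1) where
  n := c.n - 1
  U i := c.U (i + 1)
  K i := c.K (i + 1)
  U_zero := rfl
  U_mem i hi := c.U_mem (i + 1) (by omega)
  K_not_dec i hi := c.K_not_dec (i + 1) (by omega)
  K_ne_Y i hi := c.K_ne_Y (i + 1) (by omega)
  K_anc i hi := c.K_anc (i + 1) (by omega)
  left i hi := c.left (i + 1) (by omega)
  right i hi := c.right (i + 1) (by omega)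
  last := by
    rw [Nat.sub_add_cancel hn]
    exact c.last

/-- Along a directed path, either there is no decision, or there is a first one. -/
theorem decisionFree_or_exists {V : Type*} {G : Digraph V} {S : MixedPolicyScope V} {s v : V}
    (h : IsAnc (S.scopedGraph G) s v) : DecisionFree (S.scopedGraph G) S.decisions s v ∨
      ∃ X ∈ S.decisions, ∃ Z ∈ S.ctx X, DecisionFree (S.scopedGraph G) S.decisions s Z := by
  induction h with
  | refl => exact Or.inl .refl
  | @tail b c _ hbc ih =>
    rcases ih with ih | ih
    · by_cases hc : c ∈ S.decisions
      · rcases hbc with h | h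
        · exact Or.inr ⟨c, hc, b, h.2, ih⟩
        · exact absurd hc h.1
      · exact Or.inl (.tail ih ⟨hbc, hc⟩)
    · exact Or.inr ih

theorem theorem1 {V : Type*} [Fintype V] (G : Digraph V) (hG : IsDAG G)
    (S : MixedPolicyScope V) (hS : IsDAG (S.scopedGraph G)) (Y : V)
    (hYD : Y ∉ S.decisions) (hYC : ∀ X ∈ S.decisions, Y ∉ S.ctx X)
    (hA : ∀ X ∈ S.decisions, IsAnc (S.scopedGraph G) X Y)
    (hB : ∀ X ∈ S.decisions, ∀ C ∈ S.ctx X,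
      DConnected (S.scopedGraph G) {C} {Y} ({X} ∪ ((S.ctx X : Set V) \ {C})))
    (hC : ∀ X ∈ S.decisions, ∀ Z ∈ S.ctx X,
      DConnected (withPolicyNode (S.scopedGraph G) X) {none} {some Y}
        (some '' S.implied
          (((S.decisions : Set V) ∪ S.ctxOf ((S.decisions : Set V) \ {Z})) \ {Z}))) :
    ∀ X₀ ∈ S.decisions, ∀ Z₀ ∈ S.ctx X₀,
      ∃ M : SCM V Y, M.CompatibleWith G ∧ M.Material S X₀ Z₀ := by
  intro X₀ hX₀ Z₀ hZ₀
  have key := fun {X Z : V} (hX : X ∈ S.decisions) (hZ : Z ∈ S.ctx X) =>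
    MixedPolicyScope.exists_sourceChain hS hYD hYC hA hX hZ (hC X hX Z hZ)
  have hne : ∀ X ∈ S.decisions, ∀ C ∈ S.ctx X, C ≠ Y := fun X hX C hC h => hYC X hX (h ▸ hC)
  -- The vertex `B` and the first chain of sources.
  obtain ⟨B, hBd, hBY, hZB, s₀, ⟨c₀⟩, hs₀⟩ : ∃ B, B ∉ S.decisions ∧ B ≠ Y ∧
      (Z₀ = B ∨ Z₀ ∈ S.decisions ∧ (S.scopedGraph G).Adj B Z₀ ∧
        ∀ X ∈ S.decisions, B ∈ S.ctx X → X = Z₀) ∧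
      ∃ s, Nonempty (SourceChain (S.scopedGraph G) S.decisions (S.hidden Y) Y s) ∧
      (s = B ∨ s ∈ S.hidden Y ∧
        ∃ p, Down (S.scopedGraph G) (S.hidden Y) s p ∧ (S.scopedGraph G).Adj p B) := by
    by_cases hZd : Z₀ ∈ S.decisions
    · obtain ⟨B, hB, hBd, huniq⟩ := (key hX₀ hZ₀).1 hZd
      exact ⟨B, hBd, hne Z₀ hZd B hB, Or.inr ⟨hZd, Or.inl ⟨hZd, hB⟩, huniq⟩, (key hZd hB).2 hBd⟩
    · exact ⟨Z₀, hZd, hne X₀ hX₀ Z₀ hZ₀, Or.inl rfl, (key hX₀ hZ₀).2 hZd⟩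
  have hXY : X₀ ≠ Y := fun h => hYD (h ▸ hX₀)
  -- The game without a second chain.
  let P₀ : GamePlan S (S.scopedGraph G) X₀ Z₀ Y :=
    { s₀ := s₀, c₀ := c₀, B := B, s₀_eq := hs₀, B_not_dec := hBd, B_ne_Y := hBY, Z₀_eq := hZB
      on := false, s₁ := s₀, c₁ := c₀, E := ∅, s₁_mem := by simp, E_spec := by simp
      k := X₀, k_spec := by simp }
  have hdirect : DecisionFree (S.scopedGraph G) S.decisions X₀ Y →
      ∃ M : SCM V Y, M.CompatibleWith G ∧ M.Material S X₀ Z₀ := by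
    intro h
    obtain ⟨p, hp, hpY⟩ := h.exists_parent hXY.symm
    refine P₀.exists_material hG hS hYD hYC hX₀ (hA X₀ hX₀) hZ₀ (Or.inl ⟨rfl, p, ⟨hp, ?_, ?_⟩, hpY⟩)
    · exact fun h => hS Y (.single (by rwa [h] at hpY))
    · exact .single hpY
  -- The game with a second chain that starts at a collider `k`.
  have hcollider : ∀ s k, SourceChain (S.scopedGraph G) S.decisions (S.hidden Y) Y s →
      s ∈ S.hidden Y → k ∉ S.decisions → k ≠ Y → IsAnc (S.scopedGraph G) k Y →
      (∃ p, DecisionFree (S.scopedGraph G) S.decisions X₀ p ∧ (S.scopedGraph G).Adj p k) →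
      (∃ p, Down (S.scopedGraph G) (S.hidden Y) s p ∧ (S.scopedGraph G).Adj p k) →
      ∃ M : SCM V Y, M.CompatibleWith G ∧ M.Material S X₀ Z₀ := by
    intro s k c hs h1 h2 h3 h4 h5
    let P : GamePlan S (S.scopedGraph G) X₀ Z₀ Y :=
      { P₀ with
        on := true, s₁ := s, c₁ := c, s₁_mem := fun _ => Or.inl hs, E := ∅, E_spec := by simp
        k := k, k_spec := fun _ => Or.inl ⟨h1, h2, h3, h4, h5⟩ }
    exact P.exists_material hG hS hYD hYC hX₀ (hA X₀ hX₀) hZ₀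
      (Or.inl ⟨rfl, P.exists_parent_Tr_of_on rfl⟩)
  rcases decisionFree_or_exists (hA X₀ hX₀) with h | ⟨X₁, hX₁, Z₁, hZ₁, hfree⟩
  · exact hdirect h
  by_cases hZX : Z₁ = X₀
  · -- The decision `X₀` has a private context `C`.
    subst hZX
    obtain ⟨C, hC, hCd, huniq⟩ := (key hX₁ hZ₁).1 hX₀
    by_cases hCZ : C = Z₀
    · subst hCZ
      exact P₀.exists_material hG hS hYD hYC hX₀ (hA _ hX₀) hZ₀ (Or.inr (Or.inl ⟨rfl, hCd, huniq⟩))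
    · obtain ⟨s₁, ⟨c₁⟩, hs₁⟩ := (key hX₀ hC).2 hCd
      let P : GamePlan S (S.scopedGraph G) Z₁ Z₀ Y :=
        { P₀ with
          on := true, s₁ := s₁, c₁ := c₁, E := {C}
          s₁_mem := fun _ => by
            rcases hs₁ with h | h
            · exact Or.inr h
            · exact Or.inl h.1
          E_spec := by
            rintro v rfl
            exact ⟨hCd, hne _ hX₀ _ hC, hs₁.imp Eq.symm fun h => h.2⟩
          k := Z₁, k_spec := fun _ => Or.inr ⟨rfl, C, rfl, Or.inl ⟨hX₀, hC⟩⟩ }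
      refine P.exists_material hG hS hYD hYC hX₀ (hA _ hX₀) hZ₀ (Or.inr (Or.inr ⟨rfl, rfl, ?_⟩))
      intro D hD
      have hDC : D = C := hD
      rw [hDC]
      exact huniq
  · have hZ₁d : Z₁ ∉ S.decisions := hfree.eq_or_mem.resolve_left hZX
    obtain ⟨s, ⟨c⟩, hs⟩ := (key hX₁ hZ₁).2 hZ₁d
    rcases hs with rfl | ⟨hs, hp⟩
    · -- The path from `Z₁` starts with a directed path to `Y` or to a collider.
      have hfree' : ∀ {p}, Down (S.scopedGraph G) (S.hidden Y) (c.U 0) p →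
          DecisionFree (S.scopedGraph G) S.decisions X₀ p := by
        intro p hp
        rw [c.U_zero] at hp
        exact hfree.trans (Relation.ReflTransGen.mono (fun _ _ h => ⟨h.1, h.2.1⟩) _ _ hp)
      rcases Nat.eq_zero_or_pos c.n with hn | hn
      · obtain ⟨p, hp, hpY⟩ := c.last
        rw [hn] at hp
        exact hdirect ((hfree' hp).tail ⟨hpY, hYD⟩)
      · obtain ⟨p, hp, hpk⟩ := c.left 0 hn
        exact hcollider (c.U 1) (c.K 0) (c.tail hn) (c.U_mem 0 hn) (c.K_not_dec 0 hn)
          (c.K_ne_Y 0 hn) (c.K_anc 0 hn) ⟨p, hfree' hp, hpk⟩ (c.right 0 hn)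
    · exact hcollider s Z₁ c hs hZ₁d (hne X₁ hX₁ Z₁ hZ₁) (.head (Or.inl ⟨hX₁, hZ₁⟩) (hA X₁ hX₁))
        (hfree.exists_parent hZX) hp
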